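/- Let $0<p<1$, and let $[v^p]^+=v^p$ for $v\ge 0$ and $[v^p]^+=0$ for $v<0$. Let $u_0:\mathbb{R}\to\mathbb{R}$ be continuous and piecewise $C^1$, nonnegative, not identically zero, with support contained in $[-1,1]$. Let $u\in C(\mathbb{R}\times[0,\infty))\cap C^{2,1}(\mathbb{R}\times(0,\infty))$ be the global classical solution of $$u_t=u_{xx}+[u^p]^+\ \text{ on } \mathbb{R}\times(0,\infty),\qquad u(x,0)=u_0(x)\ \text{ for } x\in\mathbb{R},$$ that is bounded on $\mathbb{R}\times[0,T]$ for every $T>0$. Put $$S(t)=\sup_{x\in\mathbb{R}}\Big(u(x,t)-((1-p)t)^{\frac{1}{1-p}}\Big),\qquad r(t)=((1-p)t)^{\frac{3p-1}{2(1-p)}} .$$ Then $p=1/3$ is a transitional stability exponent, in the following sense. - If $0<p<1/3$, then $S(t)\to 0^+$ as $t\to\infty$ (that is, $S(t)\to0$ with $S(t)>0$ for all large $t$), and at the precise algebraic rate $r(t)$: there are constants $c,C>0$ with $c\,r(t)\le S(t)\le C\,r(t)$ for all sufficiently large $t$. - If $1/3<p<1$, then $S(t)\to+\infty$ as $t\to\infty$,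 and at the precise algebraic rate $r(t)$: there are constants $c,C>0$ with $c\,r(t)\le S(t)\le C\,r(t)$ for all sufficiently large $t$. - If $p=1/3$, then $\overline{c}_-(u_0)\le S(t)\le\overline{c}_+(u_0)$ for all sufficiently large $t$, where $$\overline{c}_-(u_0)=\frac{(1+\|u_0\|_\infty)^{-1}}{2\sqrt{2\pi/3}}\int_{-1}^{1}u_0(s)\,ds,\qquad \overline{c}_+(u_0)=\frac{1}{\sqrt{2\pi}}\int_{-\infty}^{\infty}\mathcal{E}(s)\,ds$$ are positive and finite, with $$\mathcal{E}(s)=\Big(\tfrac23+\Delta(s)^{2/3}\Big)^{3/2}-\Big(\tfrac23\Big)^{3/2},\qquad \Delta(s)=\frac{1}{2\sqrt{\pi}}\int_{-1}^{1}u_0(w)\,e^{-(w-s)^2/4}\,dw .$$ -/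

import Mathlib

open Filter Topology Set MeasureTheory

noncomputable section

namespace SublinearFujita

/-- The reaction function `[u^p]^+`: it is `u^p` for `u ≥ 0` and `0` for `u < 0`. -/
def reaction (p u : ℝ) : ℝ := if 0 ≤ u then u ^ p else 0

/-- `f ∈ PC^1(ℝ)`: off an exceptional set with finitely many points in each bounded interval, `f`
is continuously differentiable, and `f'` has finite one-sided limits at the exceptional points. -/
def PiecewiseC1 (f : ℝ → ℝ) : Prop :=
  ∃ F : Set ℝ, (∀ a b : ℝ, (F ∩ Icc a b).Finite) ∧
    (∀ x, x ∉ F → DifferentiableAt ℝ f x) ∧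
    ContinuousOn (deriv f) Fᶜ ∧
    ∀ a ∈ F, (∃ l : ℝ, Tendsto (deriv f) (𝓝[<] a) (𝓝 l)) ∧
      ∃ r : ℝ, Tendsto (deriv f) (𝓝[>] a) (𝓝 r)

/-- The class `K^+(ℝ)` of initial data: continuous and piecewise `C^1`, nontrivial, nonnegative,
with support in `[-1, 1]`. -/
structure KPlus (u₀ : ℝ → ℝ) : Prop where
  continuous : Continuous u₀
  piecewiseC1 : PiecewiseC1 u₀
  nontrivial : ∃ x, u₀ x ≠ 0
  nonneg : ∀ x, 0 ≤ u₀ x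
  support : tsupport u₀ ⊆ Icc (-1) 1

/-- `u ∈ C^{2,1}(ℝ × (0, ∞))`, for `u x t`: the derivatives `u_t`, `u_x`, `u_xx` exist and are
continuous in `(x, t)` on `ℝ × (0, ∞)`. -/
structure IsC21 (u : ℝ → ℝ → ℝ) : Prop where
  diff_t : ∀ x t : ℝ, 0 < t → DifferentiableAt ℝ (fun s => u x s) t
  diff_x : ∀ x t : ℝ, 0 < t → DifferentiableAt ℝ (fun y => u y t) x
  diff_xx : ∀ x t : ℝ, 0 < t → DifferentiableAt ℝ (deriv (fun y => u y t)) x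
  cont_t : ContinuousOn (fun z : ℝ × ℝ => deriv (fun s => u z.1 s) z.2) (univ ×ˢ Ioi 0)
  cont_x : ContinuousOn (fun z : ℝ × ℝ => deriv (fun y => u y z.2) z.1) (univ ×ˢ Ioi 0)
  cont_xx : ContinuousOn (fun z : ℝ × ℝ => deriv (deriv (fun y => u y z.2)) z.1)
    (univ ×ˢ Ioi 0)

/-- `u` (written `u x t`, only its values for `t ≥ 0` matter) is a global classical solution of
`u_t = u_xx + [u^p]^+` with initial data `u₀`, bounded on `ℝ × [0, T]` for every `T > 0`. -/
structure IsGlobalSolution (p : ℝ) (u₀ : ℝ → ℝ) (u : ℝ → ℝ → ℝ) : Prop where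
  cont : ContinuousOn (fun z : ℝ × ℝ => u z.1 z.2) (univ ×ˢ Ici 0)
  regular : IsC21 u
  pde : ∀ x t : ℝ, 0 < t →
    deriv (fun s => u x s) t = deriv (deriv (fun y => u y t)) x + reaction p (u x t)
  initial : ∀ x, u x 0 = u₀ x
  bounded : ∀ T : ℝ, 0 < T → ∃ M : ℝ, ∀ x t : ℝ, 0 ≤ t → t ≤ T → |u x t| ≤ M

/-- The spatially homogeneous state `u_h(t) = ((1-p)t)^{1/(1-p)}`. -/
def homState (p t : ℝ) : ℝ := ((1 - p) * t) ^ (1 / (1 - p))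

/-- `sup_{x ∈ ℝ} (u(x,t) - u_h(t))`. -/
def supExcess (p : ℝ) (u : ℝ → ℝ → ℝ) (t : ℝ) : ℝ := ⨆ x : ℝ, (u x t - homState p t)

/-- The algebraic rate `((1-p)t)^{(3p-1)/(2(1-p))}`. -/
def rate (p t : ℝ) : ℝ := ((1 - p) * t) ^ ((3 * p - 1) / (2 * (1 - p)))

/-- The supremum norm `‖u₀‖_∞`. -/
def supNorm (u₀ : ℝ → ℝ) : ℝ := ⨆ x : ℝ, |u₀ x|

/-- `Δ(s, u₀)`. -/
def Delta (u₀ : ℝ → ℝ) (s : ℝ) : ℝ :=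
  1 / (2 * √Real.pi) * ∫ w in (-1 : ℝ)..1, u₀ w * Real.exp (-(1 / 4) * (w - s) ^ 2)

/-- `ℰ(s; p, u₀)`. -/
def calE (p : ℝ) (u₀ : ℝ → ℝ) (s : ℝ) : ℝ :=
  ((1 - p) + Delta u₀ s ^ (1 - p)) ^ (1 / (1 - p)) - (1 - p) ^ (1 / (1 - p))

/-- The constant `c̄₋(u₀)`. -/
def cMinus (u₀ : ℝ → ℝ) : ℝ :=
  (1 + supNorm u₀)⁻¹ / (2 * √(2 * Real.pi / 3)) * ∫ s in (-1 : ℝ)..1, u₀ s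

/-- The constant `c̄₊(u₀)`. -/
def cPlus (u₀ : ℝ → ℝ) : ℝ :=
  1 / √(2 * Real.pi) * ∫ s : ℝ, calE (1 / 3) u₀ s

end SublinearFujita

end

/-! Write h for `homState p` and v = u - h for the excess. Then v_t = v_xx + (u^p - h^p), and
concavity of the power traps the source between two linear ones: p u^(p-1) v ≤ u^p - h^p ≤ p h^(p-1)
v, once v ≥ 0 is known. The upper slope p h^(p-1) is p/((1-p)t). Since u ≤ (‖u₀‖^(1-p) +
(1-p)t)^(1/(1-p)), the lower slope is at least p/(‖u₀‖^(1-p) + (1-p)t). Either one integrates to a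
growth factor of order t^(p/(1-p)), which multiplies a solution of the heat equation with integrable
data and hence of size t^(-1/2). The product has exponent (3p-1)/(2(1-p)), which changes sign at p =
1/3.

All comparisons go through `max_principle`, but the reaction is not Lipschitz at 0, so each use
needs a positive lower bound for one of the two functions wherever the difference is positive.

Two preliminary facts carry the argument. `homState_le` gives v ≥ 0: u lies above the heat flow of
u₀, hence is positive, and a small cosine bump growing from zero can be fitted under it.
`le_flow_heat` bounds u by the ODE flow applied to the heat flow; this is a supersolution because
the ODE flow is concave in its initial value.

The upper slope is not integrable at t = 0, so `excess_upper_bound` starts at time one. There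
`le_flow_heat` bounds v by `calE`, which is where the profile in `cPlus` comes from.
`excess_lower_bound` starts at time zero from u₀ itself and leads to `cMinus`. -/

noncomputable section

namespace SublinearFujita

/-! ### Maximum principle on a strip -/

/-- Second derivative test, necessary condition at a local maximum. -/
theorem second_deriv_nonpos_of_isLocalMax {f f' : ℝ → ℝ} {x b : ℝ} (hmax : IsLocalMax f x)
    (hf : ∀ᶠ y in 𝓝 x, HasDerivAt f (f' y) y) (hf' : HasDerivAt f' b x) : b ≤ 0 := by
  by_contra! hb
  have hd : deriv f =ᶠ[𝓝 x] f' := hf.mono fun y hy => hy.deriv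
  have hdd : deriv (deriv f) x = b := by rw [hd.deriv_eq, hf'.deriv]
  -- A positive second derivative would make the maximum also a local minimum, so f would be locally
  -- constant with vanishing second derivative.
  have hmin : IsLocalMin f x :=
    isLocalMin_of_deriv_deriv_pos (hdd ▸ hb) hmax.deriv_eq_zero hf.self_of_nhds.continuousAt
  have hconst : f =ᶠ[𝓝 x] fun _ => f x := by
    filter_upwards [hmax, hmin] with y h1 h2 using le_antisymm h1 h2
  have h2 : deriv f =ᶠ[𝓝 x] fun _ => 0 := by
    simpa using hconst.deriv
  have : deriv (deriv f) x = 0 := by simp [h2.deriv_eq]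
  linarith

/-- `f` has first derivative `g` near `x` and second derivative `b` at `x`. -/
def HasSecondDerivAt (f g : ℝ → ℝ) (b x : ℝ) : Prop :=
  (∀ᶠ y in 𝓝 x, HasDerivAt f (g y) y) ∧ HasDerivAt g b x

/-- The derivative at a maximum over an interval ending at the point is nonnegative. -/
theorem deriv_nonneg_of_left_max {f : ℝ → ℝ} {a t s : ℝ} (hst : s < t) (hf : HasDerivAt f a t)
    (hmax : ∀ r ∈ Icc s t, f r ≤ f t) : 0 ≤ a := by
  have h := hf.hasDerivWithinAt (s := Iio t)
  rw [hasDerivWithinAt_iff_tendsto_slope] at h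
  have hs : Iio t \ {t} = Iio t := by ext y; simp +contextual
  rw [hs] at h
  refine ge_of_tendsto h ?_
  filter_upwards [Ioo_mem_nhdsLT hst] with r hr
  rw [slope_def_field]
  exact div_nonneg_of_nonpos (by linarith [hmax r ⟨hr.1.le, hr.2.le⟩]) (by linarith [hr.2])

/-- Weak parabolic maximum principle on a strip, for functions bounded above. The differential
inequality is only needed where the function is positive. -/
theorem max_principle {D : ℝ → ℝ → ℝ} {T K M : ℝ} (hK : 0 ≤ K)
    (hcont : ContinuousOn (fun z : ℝ × ℝ => D z.1 z.2) (univ ×ˢ Icc 0 T))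
    (hM : ∀ x, ∀ t ∈ Icc 0 T, D x t ≤ M) (h0 : ∀ x, D x 0 ≤ 0)
    (h : ∀ x, ∀ t ∈ Ioc 0 T, 0 < D x t → ∃ (a b : ℝ) (D' : ℝ → ℝ),
      HasDerivAt (fun s => D x s) a t ∧ HasSecondDerivAt (fun y => D y t) D' b x ∧
        a ≤ b + K * D x t) :
    ∀ x, ∀ t ∈ Icc 0 T, D x t ≤ 0 := by
  intro x₀ t₀ ht₀
  by_contra! hpos
  set δ := Real.exp (-K * t₀) * D x₀ t₀ with hδ
  have hδpos : 0 < δ := by positivity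
  have hMpos : 0 < M := hpos.trans_le (hM _ _ ht₀)
  have hden : 0 < x₀ ^ 2 + 3 * t₀ + 1 := by nlinarith [sq_nonneg x₀, ht₀.1]
  -- With this ε the penalized function F equals exactly ε at (x₀, t₀). The penalty x² + 3t forces a
  -- maximum to exist; its time slope 3 exceeds its second space derivative 2.
  set ε := δ / (x₀ ^ 2 + 3 * t₀ + 1) with hε
  have hεpos : 0 < ε := by positivity
  set F : ℝ × ℝ → ℝ := fun z =>
    Real.exp (-K * z.2) * D z.1 z.2 - ε * (z.1 ^ 2 + 3 * z.2) with hF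
  have hF0 : 0 < F (x₀, t₀) := by
    have : ε * (x₀ ^ 2 + 3 * t₀ + 1) = δ := by rw [hε]; field_simp
    have : F (x₀, t₀) = ε := by simp only [hF]; linarith
    rw [this]; exact hεpos
  -- For |x| ≥ R the penalty εx² exceeds M, so F is negative there and its maximum over the box has
  -- |x| < R.
  set R := |x₀| + M / ε + 1 with hR
  have hRx : |x₀| < R := by have : 0 < M / ε := by positivity
                            linarith
  have hR1 : 1 ≤ R := by have : 0 < M / ε := by positivity
                         have := abs_nonneg x₀
                         linarith
  have hRM : M < ε * R ^ 2 := by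
    have h1 : M / ε < R := by have := abs_nonneg x₀; linarith
    have h2 : M < ε * R := by rw [div_lt_iff₀ hεpos] at h1; linarith
    nlinarith
  have hcomp : IsCompact (Icc (-R) R ×ˢ Icc 0 T) := isCompact_Icc.prod isCompact_Icc
  have hFc : ContinuousOn F (Icc (-R) R ×ˢ Icc 0 T) := by
    have : ContinuousOn (fun z : ℝ × ℝ => D z.1 z.2) (Icc (-R) R ×ˢ Icc 0 T) :=
      hcont.mono (prod_mono (subset_univ _) le_rfl)
    exact ((by fun_prop : Continuous fun z : ℝ × ℝ => Real.exp (-K * z.2)).continuousOn.mul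
      this).sub (by fun_prop)
  have hmem : (x₀, t₀) ∈ Icc (-R) R ×ˢ Icc 0 T := ⟨abs_le.1 hRx.le, ht₀⟩
  obtain ⟨⟨x, t⟩, ⟨hx, ht⟩, hmax⟩ := hcomp.exists_isMaxOn ⟨_, hmem⟩ hFc
  simp only at hx ht
  have hFx : 0 < F (x, t) := hF0.trans_le (hmax hmem)
  have hDx : 0 < D x t := by
    by_contra! hn
    have h1 := mul_nonpos_of_nonneg_of_nonpos (Real.exp_pos (-K * t)).le hn
    have h2 : 0 ≤ ε * (x ^ 2 + 3 * t) := by have := ht.1; positivity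
    simp only [hF] at hFx
    linarith
  have htpos : 0 < t := by
    rcases ht.1.eq_or_lt with h1 | h1
    · rw [← h1] at hDx; exact absurd (h0 x) (not_le.2 hDx)
    · exact h1
  have hexp : Real.exp (-K * t) ≤ 1 := Real.exp_le_one_iff.2 (by nlinarith)
  have hxR : |x| < R := by
    by_contra! hn
    have h1 : R ^ 2 ≤ x ^ 2 := by rw [← sq_abs x]; gcongr
    have h2 : Real.exp (-K * t) * D x t ≤ M := by nlinarith [hM x t ht]
    simp only [hF] at hFx
    nlinarith
  obtain ⟨a, b, D', hDt, ⟨hDx1, hDx2⟩, hab⟩ := h x t ⟨htpos, ht.2⟩ hDx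
  have hFt : HasDerivAt (fun s => F (x, s))
      ((Real.exp (-K * t) * (-K * 1)) * D x t + Real.exp (-K * t) * a - ε * (3 * 1)) t :=
    (((hasDerivAt_id t).const_mul (-K)).exp.mul hDt).sub
      ((((hasDerivAt_id t).const_mul 3).const_add (x ^ 2)).const_mul ε)
  have hFt0 := deriv_nonneg_of_left_max htpos hFt fun r hr =>
    hmax (show (x, r) ∈ _ from ⟨hx, hr.1, hr.2.trans ht.2⟩)
  have hFxx : Real.exp (-K * t) * b - ε * 2 ≤ 0 := by
    refine second_deriv_nonpos_of_isLocalMax (f := fun y => F (y, t))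
      (f' := fun y => Real.exp (-K * t) * D' y - ε * (2 * y)) (x := x) ?_ ?_ ?_
    · filter_upwards [Ioo_mem_nhds (abs_lt.1 hxR).1 (abs_lt.1 hxR).2] with y hy
      exact hmax (show (y, t) ∈ _ from ⟨⟨hy.1.le, hy.2.le⟩, ht⟩)
    · filter_upwards [hDx1] with y hy
      have := ((hasDerivAt_pow 2 y).add_const (3 * t)).const_mul ε
      exact ((hy.const_mul (Real.exp (-K * t))).sub this).congr_deriv (by norm_num)
    · have := ((hasDerivAt_id x).const_mul 2).const_mul ε
      exact ((hDx2.const_mul (Real.exp (-K * t))).sub this).congr_deriv (by norm_num)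
  -- At the maximum F_t ≥ 0 and F_xx ≤ 0, whereas the differential inequality gives F_t ≤ F_xx - ε;
  -- the factor e^(-Kt) absorbs K D.
  have := mul_le_mul_of_nonneg_left hab (Real.exp_pos (-K * t)).le
  nlinarith

/-! ### Heat kernel and heat semigroup -/

/-- The Gaussian profile at time one. -/
def gauss (z : ℝ) : ℝ := 1 / (2 * √Real.pi) * Real.exp (-(1 / 4) * z ^ 2)

/-- The heat semigroup, in self-similar variables. -/
def heat (f : ℝ → ℝ) (x t : ℝ) : ℝ := ∫ z, f (x + √t * z) * gauss z

/-- The heat kernel. -/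
def heatKernel (x t : ℝ) : ℝ := 1 / (2 * √Real.pi) * ((√t)⁻¹ * Real.exp (-(x ^ 2 / (4 * t))))

theorem gauss_pos (z : ℝ) : 0 < gauss z := by
  have := Real.pi_pos
  unfold gauss; positivity

theorem continuous_gauss : Continuous gauss := by unfold gauss; fun_prop

theorem integrable_gauss : Integrable gauss :=
  (integrable_exp_neg_mul_sq (by norm_num : (0 : ℝ) < 1 / 4)).const_mul _

theorem integral_gauss_eq_one : ∫ z, gauss z = 1 := by
  unfold gauss
  rw [integral_const_mul, integral_gaussian, show Real.pi / (1 / 4) = 2 ^ 2 * Real.pi by ring,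
    Real.sqrt_mul (by norm_num), Real.sqrt_sq (by norm_num)]
  have := Real.sqrt_pos.2 Real.pi_pos
  field_simp

section HeatBasic

variable {f : ℝ → ℝ} {M : ℝ}

theorem integrable_heat_integrand (hf : Continuous f) (hM : ∀ x, |f x| ≤ M) (x t : ℝ) :
    Integrable fun z => f (x + √t * z) * gauss z :=
  integrable_gauss.bdd_mul (c := M) (by fun_prop) (Eventually.of_forall fun z => hM _)

theorem continuous_heat (hf : Continuous f) (hM : ∀ x, |f x| ≤ M) :
    Continuous fun z : ℝ × ℝ => heat f z.1 z.2 := by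
  unfold heat
  refine continuous_of_dominated (bound := fun z => M * gauss z) ?_ ?_ ?_ ?_
  · intro w
    have := continuous_gauss
    exact (by fun_prop : Continuous fun z => f (w.1 + √w.2 * z) * gauss z).aestronglyMeasurable
  · intro w
    refine Eventually.of_forall fun z => ?_
    rw [norm_mul, Real.norm_of_nonneg (gauss_pos z).le]
    exact mul_le_mul_of_nonneg_right (hM _) (gauss_pos z).le
  · exact integrable_gauss.const_mul M
  · exact Eventually.of_forall fun z => by fun_prop

theorem heat_le (hf : Continuous f) (hM : ∀ x, |f x| ≤ M) (x t : ℝ) : heat f x t ≤ M := by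
  calc heat f x t ≤ ∫ z, M * gauss z :=
        integral_mono (integrable_heat_integrand hf hM x t) (integrable_gauss.const_mul M)
          fun z => mul_le_mul_of_nonneg_right ((le_abs_self _).trans (hM _)) (gauss_pos z).le
    _ = M := by rw [integral_const_mul, integral_gauss_eq_one, mul_one]

theorem heat_nonneg (hf : ∀ x, 0 ≤ f x) (x t : ℝ) : 0 ≤ heat f x t :=
  integral_nonneg fun z => mul_nonneg (hf _) (gauss_pos z).le

theorem heat_zero (x : ℝ) : heat f x 0 = f x := by
  simp [heat, integral_const_mul, integral_gauss_eq_one]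

/-- Substitution y = x + √t z. The self-similar form is continuous up to t = 0 (and beyond, as √t =
0 for t ≤ 0); the kernel form is the one to differentiate. -/
theorem heat_eq_kernel (f : ℝ → ℝ) (x : ℝ) {t : ℝ} (ht : 0 < t) :
    heat f x t = ∫ y, f y * heatKernel (x - y) t := by
  have hs : 0 < √t := Real.sqrt_pos.2 ht
  have h1 := integral_add_left_eq_self (μ := volume) (fun y => f y * heatKernel (x - y) t) x
  have h2 := Measure.integral_comp_mul_left (fun z => f (x + z) * heatKernel (x - (x + z)) t) √t
  rw [← h1]
  rw [abs_of_pos (inv_pos.2 hs), smul_eq_mul, ← div_eq_inv_mul, eq_div_iff hs.ne'] at h2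
  rw [← h2, mul_comm, ← integral_const_mul]
  refine integral_congr_ae (Eventually.of_forall fun z => ?_)
  have h3 : √t ^ 2 = t := Real.sq_sqrt ht.le
  have h4 : (x - (x + √t * z)) ^ 2 / (4 * t) = 1 / 4 * z ^ 2 := by
    rw [show (x - (x + √t * z)) ^ 2 = √t ^ 2 * z ^ 2 by ring, h3]; field_simp
  simp only [heatKernel, gauss, h4]
  field_simp

theorem heatKernel_pos (x : ℝ) {t : ℝ} (ht : 0 < t) : 0 < heatKernel x t := by
  have := Real.pi_pos
  unfold heatKernel; positivity

theorem heatKernel_le (x : ℝ) {t : ℝ} (ht : 0 < t) :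
    heatKernel x t ≤ 1 / (2 * √Real.pi) * (√t)⁻¹ := by
  have := Real.pi_pos
  unfold heatKernel
  refine mul_le_mul_of_nonneg_left ?_ (by positivity)
  refine mul_le_of_le_one_right (by positivity) (Real.exp_le_one_iff.2 ?_)
  have : 0 ≤ x ^ 2 / (4 * t) := by positivity
  linarith

theorem continuous_heatKernel (t : ℝ) : Continuous fun x => heatKernel x t := by
  unfold heatKernel; fun_prop

theorem hasDerivAt_heatKernel_x (x t : ℝ) :
    HasDerivAt (fun y => heatKernel y t) (-(x / (2 * t)) * heatKernel x t) x := by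
  have h := ((((hasDerivAt_pow 2 x).div_const (4 * t)).neg.exp).const_mul (√t)⁻¹).const_mul
    (1 / (2 * √Real.pi))
  refine h.congr_deriv ?_
  simp only [heatKernel, Pi.neg_apply]
  push_cast
  have : (2 * x ^ (2 - 1) / (4 * t)) = x / (2 * t) := by
    rw [show (4 : ℝ) * t = 2 * (2 * t) by ring]; norm_num; rw [mul_div_mul_left _ _ two_ne_zero]
  rw [this]; ring

theorem hasDerivAt_heatKernel_xx (x t : ℝ) :
    HasDerivAt (fun y => -(y / (2 * t)) * heatKernel y t)
      ((x ^ 2 / (4 * t ^ 2) - 1 / (2 * t)) * heatKernel x t) x := by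
  refine ((((hasDerivAt_id x).div_const (2 * t)).neg).mul (hasDerivAt_heatKernel_x x t)).congr_deriv
    ?_
  have : x ^ 2 / (4 * t ^ 2) = (x / (2 * t)) * (x / (2 * t)) := by
    rw [div_mul_div_comm]; ring_nf
  rw [this]; simp only [id, Pi.neg_apply]; ring

/-- The value is that of `hasDerivAt_heatKernel_xx`, that is, the kernel solves the heat equation;
hence `heatXX` is also the time derivative. -/
theorem hasDerivAt_heatKernel_t (x : ℝ) {t : ℝ} (ht : 0 < t) :
    HasDerivAt (fun s => heatKernel x s)
      ((x ^ 2 / (4 * t ^ 2) - 1 / (2 * t)) * heatKernel x t) t := by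
  have hs : 0 < √t := Real.sqrt_pos.2 ht
  have h1 : HasDerivAt (fun s => (√s)⁻¹) (-(1 / (2 * √t)) / √t ^ 2) t :=
    (Real.hasDerivAt_sqrt ht.ne').inv hs.ne'
  have h2 : HasDerivAt (fun s => x ^ 2 / (4 * s)) ((0 * (4 * t) - x ^ 2 * (4 * 1)) / (4 * t) ^ 2) t :=
    (hasDerivAt_const t (x ^ 2)).div ((hasDerivAt_id t).const_mul 4) (by positivity)
  refine ((h1.mul h2.neg.exp).const_mul (1 / (2 * √Real.pi))).congr_deriv ?_
  simp only [heatKernel, Pi.neg_apply]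
  have := Real.sqrt_pos.2 Real.pi_pos
  rw [Real.sq_sqrt ht.le]
  field_simp
  ring

end HeatBasic

/-- This is z e^(-z) ≤ 1 with z = x²/(4t). It gives bounds uniform in x, so that mere integrability
of f dominates the differentiated integrals. -/
theorem heatKernel_sq_le (x : ℝ) {t : ℝ} (ht : 0 < t) :
    x ^ 2 / (4 * t ^ 2) * heatKernel x t ≤ 1 / (2 * √Real.pi) * (√t)⁻¹ * t⁻¹ := by
  have hpi := Real.sqrt_pos.2 Real.pi_pos
  have hs := Real.sqrt_pos.2 ht
  have h : x ^ 2 / (4 * t) * Real.exp (-(x ^ 2 / (4 * t))) ≤ 1 := by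
    have := Real.add_one_le_exp (x ^ 2 / (4 * t))
    rw [Real.exp_neg, ← div_eq_mul_inv, div_le_one (Real.exp_pos _)]
    linarith
  calc x ^ 2 / (4 * t ^ 2) * heatKernel x t
      = 1 / (2 * √Real.pi) * (√t)⁻¹ * t⁻¹ * (x ^ 2 / (4 * t) * Real.exp (-(x ^ 2 / (4 * t)))) := by
        unfold heatKernel; field_simp
    _ ≤ _ := mul_le_of_le_one_right (by positivity) h

theorem abs_heatKernel_x_le (x : ℝ) {t : ℝ} (ht : 0 < t) :
    |-(x / (2 * t)) * heatKernel x t| ≤ 1 / (2 * √Real.pi) * (√t)⁻¹ * (1 + t⁻¹) := by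
  have hk := heatKernel_pos x ht
  have h1 : |x / (2 * t)| ≤ 1 + x ^ 2 / (4 * t ^ 2) := by
    have : x ^ 2 / (4 * t ^ 2) = |x / (2 * t)| ^ 2 := by rw [sq_abs, div_pow]; ring_nf
    rw [this]; nlinarith [sq_nonneg (|x / (2 * t)| - 1)]
  rw [abs_mul, abs_neg, abs_of_pos hk]
  nlinarith [heatKernel_le x ht, heatKernel_sq_le x ht, mul_le_mul_of_nonneg_right h1 hk.le]

theorem abs_heatKernel_xx_le (x : ℝ) {a t : ℝ} (ha : 0 < a) (hat : a ≤ t) :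
    |(x ^ 2 / (4 * t ^ 2) - 1 / (2 * t)) * heatKernel x t| ≤
      2 * (1 / (2 * √Real.pi) * (√a)⁻¹ * a⁻¹) := by
  have ht := ha.trans_le hat
  have hpi := Real.sqrt_pos.2 Real.pi_pos
  have hs := Real.sqrt_pos.2 ha
  have hk := heatKernel_pos x ht
  have h0 : 0 ≤ x ^ 2 / (4 * t ^ 2) * heatKernel x t := by positivity
  have h1 : 1 / (2 * t) * heatKernel x t ≤ 1 / (2 * √Real.pi) * (√t)⁻¹ * t⁻¹ := by
    rw [mul_comm]
    refine mul_le_mul (heatKernel_le x ht) ?_ (by positivity) (by positivity)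
    rw [one_div, mul_inv]; have : 0 < t⁻¹ := by positivity
    linarith
  have h2 : 0 ≤ 1 / (2 * t) * heatKernel x t := by positivity
  have h3 : 1 / (2 * √Real.pi) * (√t)⁻¹ * t⁻¹ ≤ 1 / (2 * √Real.pi) * (√a)⁻¹ * a⁻¹ := by
    gcongr
  rw [sub_mul, abs_le]
  constructor <;> linarith [heatKernel_sq_le x ht]

/-- First space derivative of `heat f`. -/
def heatX (f : ℝ → ℝ) (x t : ℝ) : ℝ :=
  ∫ y, f y * (-((x - y) / (2 * t)) * heatKernel (x - y) t)

/-- Second space derivative of `heat f`. -/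
def heatXX (f : ℝ → ℝ) (x t : ℝ) : ℝ :=
  ∫ y, f y * (((x - y) ^ 2 / (4 * t ^ 2) - 1 / (2 * t)) * heatKernel (x - y) t)

section HeatDeriv

variable {f : ℝ → ℝ}

theorem integrable_mul_kernel (hf : Integrable f) (x : ℝ) {t : ℝ} (ht : 0 < t) :
    Integrable fun y => f y * heatKernel (x - y) t := by
  have hc : Continuous fun y => heatKernel (x - y) t :=
    (continuous_heatKernel t).comp (by fun_prop)
  refine hf.mul_bdd (c := 1 / (2 * √Real.pi) * (√t)⁻¹) hc.aestronglyMeasurable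
    (Eventually.of_forall fun y => ?_)
  rw [Real.norm_of_nonneg (heatKernel_pos _ ht).le]
  exact heatKernel_le _ ht

theorem hasDerivAt_heat_x (hf : Integrable f) (x : ℝ) {t : ℝ} (ht : 0 < t) :
    HasDerivAt (fun y => heat f y t) (heatX f x t) x := by
  have hk := continuous_heatKernel t
  have he : (fun y => heat f y t) = fun y => ∫ w, f w * heatKernel (y - w) t := by
    funext y; exact heat_eq_kernel f y ht
  rw [he]
  refine (hasDerivAt_integral_of_dominated_loc_of_deriv_le
    (F := fun y w => f w * heatKernel (y - w) t)
    (F' := fun y w => f w * (-((y - w) / (2 * t)) * heatKernel (y - w) t))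
    (bound := fun w => ‖f w‖ * (1 / (2 * √Real.pi) * (√t)⁻¹ * (1 + t⁻¹)))
    (s := univ) univ_mem ?_ ?_ ?_ ?_ ?_ ?_).2
  · exact Eventually.of_forall fun y => (integrable_mul_kernel hf y ht).aestronglyMeasurable
  · exact integrable_mul_kernel hf x ht
  · exact hf.aestronglyMeasurable.mul (by fun_prop :
      Continuous fun w => (-((x - w) / (2 * t)) * heatKernel (x - w) t)).aestronglyMeasurable
  · refine Eventually.of_forall fun w y _ => ?_
    rw [norm_mul]
    exact mul_le_mul_of_nonneg_left (abs_heatKernel_x_le _ ht) (norm_nonneg _)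
  · exact hf.norm.mul_const _
  · refine Eventually.of_forall fun w y _ => ?_
    exact (((hasDerivAt_heatKernel_x (y - w) t).comp_sub_const y w)).const_mul (f w)

theorem hasDerivAt_heat_xx (hf : Integrable f) (x : ℝ) {t : ℝ} (ht : 0 < t) :
    HasDerivAt (fun y => heatX f y t) (heatXX f x t) x := by
  have hk := continuous_heatKernel t
  have hm := fun y => hf.aestronglyMeasurable.mul (by fun_prop :
      Continuous fun w => (-((y - w) / (2 * t)) * heatKernel (y - w) t)).aestronglyMeasurable
  refine (hasDerivAt_integral_of_dominated_loc_of_deriv_le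
    (F := fun y w => f w * (-((y - w) / (2 * t)) * heatKernel (y - w) t))
    (F' := fun y w => f w * (((y - w) ^ 2 / (4 * t ^ 2) - 1 / (2 * t)) * heatKernel (y - w) t))
    (bound := fun w => ‖f w‖ * (2 * (1 / (2 * √Real.pi) * (√t)⁻¹ * t⁻¹)))
    (s := univ) univ_mem ?_ ?_ ?_ ?_ ?_ ?_).2
  · exact Eventually.of_forall hm
  · refine (hf.norm.mul_const (1 / (2 * √Real.pi) * (√t)⁻¹ * (1 + t⁻¹))).mono' (hm x)
      (Eventually.of_forall fun w => ?_)
    rw [norm_mul]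
    exact mul_le_mul_of_nonneg_left (abs_heatKernel_x_le _ ht) (norm_nonneg _)
  · exact hf.aestronglyMeasurable.mul (by fun_prop : Continuous fun w =>
      (((x - w) ^ 2 / (4 * t ^ 2) - 1 / (2 * t)) * heatKernel (x - w) t)).aestronglyMeasurable
  · refine Eventually.of_forall fun w y _ => ?_
    rw [norm_mul]
    exact mul_le_mul_of_nonneg_left (abs_heatKernel_xx_le _ ht le_rfl) (norm_nonneg _)
  · exact hf.norm.mul_const _
  · refine Eventually.of_forall fun w y _ => ?_
    exact (((hasDerivAt_heatKernel_xx (y - w) t).comp_sub_const y w)).const_mul (f w)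

theorem hasDerivAt_heat_t (hf : Integrable f) (x : ℝ) {t : ℝ} (ht : 0 < t) :
    HasDerivAt (fun s => heat f x s) (heatXX f x t) t := by
  have hk := continuous_heatKernel t
  have he : (fun s => heat f x s) =ᶠ[𝓝 t] fun s => ∫ w, f w * heatKernel (x - w) s := by
    filter_upwards [lt_mem_nhds ht] with s hs using heat_eq_kernel f x hs
  refine HasDerivAt.congr_of_eventuallyEq ?_ he
  -- The kernel bound degenerates as the time tends to 0, so domination is taken over times beyond
  -- t/2.
  have ht2 : 0 < t / 2 := by positivity
  refine (hasDerivAt_integral_of_dominated_loc_of_deriv_le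
    (F := fun s w => f w * heatKernel (x - w) s)
    (F' := fun s w => f w * (((x - w) ^ 2 / (4 * s ^ 2) - 1 / (2 * s)) * heatKernel (x - w) s))
    (bound := fun w => ‖f w‖ * (2 * (1 / (2 * √Real.pi) * (√(t / 2))⁻¹ * (t / 2)⁻¹)))
    (s := Ioi (t / 2)) (Ioi_mem_nhds (by linarith)) ?_ ?_ ?_ ?_ ?_ ?_).2
  · filter_upwards [lt_mem_nhds ht] with s hs
      using (integrable_mul_kernel hf x hs).aestronglyMeasurable
  · exact integrable_mul_kernel hf x ht
  · exact hf.aestronglyMeasurable.mul (by fun_prop : Continuous fun w =>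
      (((x - w) ^ 2 / (4 * t ^ 2) - 1 / (2 * t)) * heatKernel (x - w) t)).aestronglyMeasurable
  · refine Eventually.of_forall fun w s hs => ?_
    rw [norm_mul]
    exact mul_le_mul_of_nonneg_left (abs_heatKernel_xx_le _ ht2 (le_of_lt hs)) (norm_nonneg _)
  · exact hf.norm.mul_const _
  · refine Eventually.of_forall fun w s hs => ?_
    exact (hasDerivAt_heatKernel_t (x - w) (ht2.trans hs)).const_mul (f w)

theorem hasSecondDerivAt_heat (hf : Integrable f) (x : ℝ) {t : ℝ} (ht : 0 < t) :
    HasSecondDerivAt (fun y => heat f y t) (fun y => heatX f y t) (heatXX f x t) x :=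
  ⟨Eventually.of_forall fun y => hasDerivAt_heat_x hf y ht, hasDerivAt_heat_xx hf x ht⟩

theorem heat_le_integral (hf : Integrable f) (h0 : ∀ x, 0 ≤ f x) (x : ℝ) {t : ℝ} (ht : 0 < t) :
    heat f x t ≤ 1 / (2 * √Real.pi) * (√t)⁻¹ * ∫ y, f y := by
  rw [heat_eq_kernel f x ht, mul_comm, ← integral_mul_const]
  exact integral_mono (integrable_mul_kernel hf x ht) (hf.mul_const _)
    fun y => mul_le_mul_of_nonneg_left (heatKernel_le _ ht) (h0 y)

theorem heat_pos (hc : Continuous f) {M : ℝ} (hM : ∀ x, |f x| ≤ M)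
    (h0 : ∀ x, 0 ≤ f x) (hne : ∃ x, f x ≠ 0) (x : ℝ) {t : ℝ} (ht : 0 < t) : 0 < heat f x t := by
  obtain ⟨w, hw⟩ := hne
  have hs := Real.sqrt_pos.2 ht
  have hg := continuous_gauss
  refine integral_pos_of_integrable_nonneg_nonzero (x := (w - x) / √t) (by fun_prop)
    (integrable_heat_integrand hc hM x t) (fun z => mul_nonneg (h0 _) (gauss_pos z).le) ?_
  have : x + √t * ((w - x) / √t) = w := by field_simp; ring
  rw [this]
  exact mul_ne_zero hw (gauss_pos _).ne'

theorem le_heat_zero (hf : Integrable f) (h0 : ∀ x, 0 ≤ f x) (hs : Function.support f ⊆ Icc (-1) 1)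
    {t : ℝ} (ht : 0 < t) :
    1 / (2 * √Real.pi) * (√t)⁻¹ * Real.exp (-(1 / (4 * t))) * ∫ y, f y ≤ heat f 0 t := by
  have hpi := Real.sqrt_pos.2 Real.pi_pos
  rw [heat_eq_kernel f 0 ht, mul_comm, ← integral_mul_const]
  refine integral_mono (hf.mul_const _) (integrable_mul_kernel hf 0 ht) fun y => ?_
  by_cases hy : f y = 0
  · simp [hy]
  · have hy1 := hs hy
    refine mul_le_mul_of_nonneg_left ?_ (h0 y)
    rw [heatKernel, mul_assoc]
    have : (0 - y) ^ 2 ≤ 1 := by nlinarith [hy1.1, hy1.2]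
    gcongr

end HeatDeriv

/-! ### Second derivatives and the power nonlinearity -/

section SecondDeriv

variable {f g f' g' : ℝ → ℝ} {a b x : ℝ}

theorem HasSecondDerivAt.sub (hf : HasSecondDerivAt f f' a x) (hg : HasSecondDerivAt g g' b x) :
    HasSecondDerivAt (fun y => f y - g y) (fun y => f' y - g' y) (a - b) x :=
  ⟨by filter_upwards [hf.1, hg.1] with y h1 h2 using h1.sub h2, hf.2.sub hg.2⟩

theorem HasSecondDerivAt.const_mul (c : ℝ) (hf : HasSecondDerivAt f f' a x) :
    HasSecondDerivAt (fun y => c * f y) (fun y => c * f' y) (c * a) x :=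
  ⟨hf.1.mono fun _ h => h.const_mul c, hf.2.const_mul c⟩

theorem HasSecondDerivAt.add_const (c : ℝ) (hf : HasSecondDerivAt f f' a x) :
    HasSecondDerivAt (fun y => f y + c) f' a x :=
  ⟨hf.1.mono fun _ h => h.add_const c, hf.2⟩

theorem HasSecondDerivAt.congr_of_eventuallyEq (hf : HasSecondDerivAt f f' a x)
    (h : g =ᶠ[𝓝 x] f) : HasSecondDerivAt g f' a x :=
  ⟨by filter_upwards [hf.1, h.eventuallyEq_nhds] with y h1 h2 using h1.congr_of_eventuallyEq h2,
    hf.2⟩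

end SecondDeriv

/-- Tangent line inequality for the concave power `a ↦ a ^ p`. -/
theorem rpow_sub_rpow_le {p a b : ℝ} (hp0 : 0 < p) (hp1 : p < 1) (ha : 0 ≤ a) (hb : 0 < b) :
    a ^ p - b ^ p ≤ p * b ^ (p - 1) * (a - b) := by
  have h := rpow_one_add_le_one_add_mul_self (s := a / b - 1) (p := p)
    (by have : 0 ≤ a / b := by positivity
        linarith) hp0.le hp1.le
  rw [add_sub_cancel, Real.div_rpow ha hb.le, div_le_iff₀ (by positivity)] at h
  rw [Real.rpow_sub_one hb.ne']
  have : (1 + p * (a / b - 1)) * b ^ p = b ^ p + p * (b ^ p / b) * (a - b) := by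
    field_simp
  linarith

theorem reaction_of_nonneg {p v : ℝ} (hv : 0 ≤ v) : reaction p v = v ^ p := by
  simp [reaction, hv]

theorem reaction_nonneg (p v : ℝ) : 0 ≤ reaction p v := by
  unfold reaction; split_ifs with h
  · positivity
  · exact le_rfl

/-! ### Initial data -/

namespace KPlus

variable {u₀ : ℝ → ℝ} (h : KPlus u₀)
include h

theorem hasCompactSupport : HasCompactSupport u₀ :=
  isCompact_Icc.of_isClosed_subset (isClosed_tsupport u₀) h.support

theorem integrable : Integrable u₀ := h.continuous.integrable_of_hasCompactSupport h.hasCompactSupport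

theorem abs_le_supNorm (x : ℝ) : |u₀ x| ≤ supNorm u₀ := by
  obtain ⟨C, hC⟩ := h.hasCompactSupport.exists_bound_of_continuous h.continuous
  exact le_ciSup (f := fun x => |u₀ x|) ⟨C, by rintro _ ⟨y, rfl⟩; exact hC y⟩ x

theorem le_supNorm (x : ℝ) : u₀ x ≤ supNorm u₀ := (le_abs_self _).trans (h.abs_le_supNorm x)

theorem supNorm_pos : 0 < supNorm u₀ := by
  obtain ⟨x, hx⟩ := h.nontrivial
  exact (abs_pos.2 hx).trans_le (h.abs_le_supNorm x)

theorem integral_pos : 0 < ∫ x, u₀ x := by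
  obtain ⟨x, hx⟩ := h.nontrivial
  exact integral_pos_of_integrable_nonneg_nonzero h.continuous h.integrable h.nonneg hx

/-- The set where a continuous function is nonzero is open, so it lies in the interior of [-1, 1].
Integrals over (-1, 1] are then integrals over the line. -/
theorem support_subset_Ioo : Function.support u₀ ⊆ Ioo (-1) 1 := by
  rw [← interior_Icc]
  exact interior_maximal ((subset_tsupport u₀).trans h.support) h.continuous.isOpen_support

theorem intervalIntegral_mul_eq (g : ℝ → ℝ) :
    ∫ x in (-1 : ℝ)..1, u₀ x * g x = ∫ x, u₀ x * g x := by
  refine intervalIntegral.integral_eq_integral_of_support_subset ?_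
  exact (Function.support_mul_subset_left _ _).trans
    (h.support_subset_Ioo.trans Ioo_subset_Ioc_self)

theorem intervalIntegral_eq : ∫ x in (-1 : ℝ)..1, u₀ x = ∫ x, u₀ x :=
  intervalIntegral.integral_eq_integral_of_support_subset
    (h.support_subset_Ioo.trans Ioo_subset_Ioc_self)

theorem delta_eq_heat (s : ℝ) : Delta u₀ s = heat u₀ s 1 := by
  rw [Delta, h.intervalIntegral_mul_eq (fun w => Real.exp (-(1 / 4) * (w - s) ^ 2)),
    heat_eq_kernel u₀ s one_pos, ← integral_const_mul]
  refine integral_congr_ae (Eventually.of_forall fun w => ?_)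
  simp only [heatKernel, Real.sqrt_one, inv_one, one_mul, mul_one]
  rw [show -(1 / 4) * (w - s) ^ 2 = -((s - w) ^ 2 / 4) by ring]
  ring

end KPlus

/-! ### Comparison with the heat flow -/

namespace IsGlobalSolution

variable {p : ℝ} {u₀ : ℝ → ℝ} {u : ℝ → ℝ → ℝ} (hu : IsGlobalSolution p u₀ u)
include hu

theorem continuousOn_strip {τ T : ℝ} (hτ : 0 ≤ τ) :
    ContinuousOn (fun z : ℝ × ℝ => u z.1 (τ + z.2)) (univ ×ˢ Icc 0 T) := by
  refine hu.cont.comp (f := fun z : ℝ × ℝ => (z.1, τ + z.2)) (by fun_prop) fun z hz => ?_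
  exact ⟨mem_univ _, add_nonneg hτ hz.2.1⟩

theorem hasDerivAt_t (x : ℝ) {t : ℝ} (ht : 0 < t) :
    HasDerivAt (fun s => u x s) (deriv (deriv fun y => u y t) x + reaction p (u x t)) t :=
  hu.pde x t ht ▸ (hu.regular.diff_t x t ht).hasDerivAt

theorem hasSecondDerivAt (x : ℝ) {t : ℝ} (ht : 0 < t) :
    HasSecondDerivAt (fun y => u y t) (deriv fun y => u y t) (deriv (deriv fun y => u y t) x) x :=
  ⟨Eventually.of_forall fun y => (hu.regular.diff_x y t ht).hasDerivAt,
    (hu.regular.diff_xx x t ht).hasDerivAt⟩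

/-- The reaction is nonnegative, so u is a supersolution of the heat equation. Its main use is
strict positivity of u for t > 0. -/
theorem heat_le (h₀ : KPlus u₀) (x : ℝ) {t : ℝ} (ht : 0 ≤ t) : heat u₀ x t ≤ u x t := by
  obtain ⟨M, hM⟩ := hu.bounded (t + 1) (by linarith)
  have key := max_principle (D := fun x t => heat u₀ x t - u x t) (T := t) (K := 0)
    (M := supNorm u₀ + M) le_rfl ?_ ?_ ?_ ?_ x t ⟨ht, le_rfl⟩
  · linarith
  · have := hu.continuousOn_strip (τ := 0) (T := t) le_rfl
    simp only [zero_add] at this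
    exact (continuous_heat h₀.continuous h₀.abs_le_supNorm).continuousOn.sub this
  · intro y s hs
    have h1 := (abs_le.1 (hM y s hs.1 (by linarith [hs.2]))).1
    have h2 := SublinearFujita.heat_le h₀.continuous h₀.abs_le_supNorm y s
    linarith
  · intro y; simp [heat_zero, hu.initial]
  · intro y s hs _
    refine ⟨_, _, _, (hasDerivAt_heat_t h₀.integrable y hs.1).sub (hu.hasDerivAt_t y hs.1),
      (hasSecondDerivAt_heat h₀.integrable y hs.1).sub (hu.hasSecondDerivAt y hs.1), ?_⟩
    have := reaction_nonneg p (u y s)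
    linarith

theorem pos (h₀ : KPlus u₀) (x : ℝ) {t : ℝ} (ht : 0 < t) : 0 < u x t :=
  (heat_pos h₀.continuous h₀.abs_le_supNorm h₀.nonneg h₀.nontrivial x ht).trans_le
    (hu.heat_le h₀ x ht.le)

/-- The nonlinear flow applied to a positive solution of the heat equation is a supersolution. -/
theorem le_of_heat_supersolution (hp0 : 0 < p) (hp1 : p < 1) {w w' w'' : ℝ → ℝ → ℝ} {ε : ℝ}
    (hε : 0 < ε) (hw : ∀ x t, ε ≤ w x t) (hwc : Continuous fun z : ℝ × ℝ => w z.1 z.2)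
    (hwt : ∀ x t, 0 < t → HasDerivAt (fun s => w x s) (w'' x t) t)
    (hwx : ∀ x t, 0 < t → HasDerivAt (fun y => w y t) (w' x t) x)
    (hwxx : ∀ x t, 0 < t → HasDerivAt (fun y => w' y t) (w'' x t) x)
    (h0 : ∀ x, u₀ x ≤ w x 0) (x : ℝ) {t : ℝ} (ht : 0 ≤ t) :
    u x t ≤ (w x t ^ (1 - p) + (1 - p) * t) ^ (1 / (1 - p)) := by
  have hq : 0 < 1 - p := by linarith
  obtain ⟨M, hM⟩ := hu.bounded (t + 1) (by linarith)
  have hwpos : ∀ x t, 0 < w x t := fun x t => hε.trans_le (hw x t)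
  have hY : ∀ x t, 0 ≤ t → w x t ^ (1 - p) ≤ w x t ^ (1 - p) + (1 - p) * t := fun x t ht => by
    have := mul_nonneg hq.le ht
    linarith
  have hYpos : ∀ x t, 0 ≤ t → 0 < w x t ^ (1 - p) + (1 - p) * t := fun x t ht =>
    (Real.rpow_pos_of_pos (hwpos x t) _).trans_le (hY x t ht)
  have hroot : ∀ x t, (w x t ^ (1 - p)) ^ (1 / (1 - p)) = w x t := fun x t => by
    rw [← Real.rpow_mul (hwpos x t).le, mul_one_div_cancel hq.ne', Real.rpow_one]
  have hφ : ∀ x t, 0 ≤ t → w x t ≤ (w x t ^ (1 - p) + (1 - p) * t) ^ (1 / (1 - p)) :=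
    fun x t ht => by
      have := Real.rpow_le_rpow (Real.rpow_nonneg (hwpos x t).le _) (hY x t ht)
        (one_div_pos.2 hq).le
      rwa [hroot] at this
  have hm1 : 1 / (1 - p) - 1 = p / (1 - p) := by field_simp; ring
  -- The comparison function stays above w ≥ ε, so the tangent slope of the reaction there is at
  -- most p ε^(p-1); this is K.
  have key := max_principle
    (D := fun x t => u x t - (w x t ^ (1 - p) + (1 - p) * t) ^ (1 / (1 - p))) (T := t)
    (K := p * ε ^ (p - 1)) (M := M) (by positivity) ?_ ?_ ?_ ?_ x t ⟨ht, le_rfl⟩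
  · linarith
  · have := hu.continuousOn_strip (τ := 0) (T := t) le_rfl
    simp only [zero_add] at this
    refine this.sub (Continuous.continuousOn ?_)
    refine Continuous.rpow_const (Continuous.add ?_ (by fun_prop))
      fun z => Or.inr (one_div_pos.2 hq).le
    exact hwc.rpow_const fun z => Or.inr hq.le
  · intro y s hs
    have h1 := (abs_le.1 (hM y s hs.1 (by linarith [hs.2]))).2
    have := (hwpos y s).trans_le (hφ y s hs.1)
    linarith
  · intro y
    rw [hu.initial, mul_zero, add_zero, hroot]
    linarith [h0 y]
  · intro y s hs hD
    have hYs := hYpos y s hs.1.le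
    have hws := hwpos y s
    set q := p / (1 - p) with hqdef
    have hwd : ∀ z, HasDerivAt (fun z => w z s ^ (1 - p) + (1 - p) * s)
        (w' z s * (1 - p) * w z s ^ (1 - p - 1)) z := fun z =>
      ((hwx z s hs.1).rpow_const (Or.inl (hwpos z s).ne')).add_const _
    have e1 : 1 - p - 1 = -p := by ring
    have hx1 : ∀ z, HasDerivAt (fun z => (w z s ^ (1 - p) + (1 - p) * s) ^ (1 / (1 - p)))
        ((w z s ^ (1 - p) + (1 - p) * s) ^ q * (w z s ^ (-p) * w' z s)) z := fun z => by
      refine ((hwd z).rpow_const (Or.inl (hYpos z s hs.1.le).ne')).congr_deriv ?_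
      rw [hm1, e1]; field_simp
    have hx2 := ((hwd y).rpow_const (p := q) (Or.inl hYs.ne')).mul
      (((hwx y s hs.1).rpow_const (p := -p) (Or.inl hws.ne')).mul (hwxx y s hs.1))
    have ht1 : HasDerivAt (fun r => (w y r ^ (1 - p) + (1 - p) * r) ^ (1 / (1 - p)))
        ((w y s ^ (1 - p) + (1 - p) * s) ^ q * (w y s ^ (-p) * w'' y s + 1)) s := by
      have := ((hwt y s hs.1).rpow_const (p := 1 - p) (Or.inl hws.ne')).add
        ((hasDerivAt_id s).const_mul (1 - p))
      refine (this.rpow_const (p := 1 / (1 - p)) (Or.inl hYs.ne')).congr_deriv ?_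
      simp only [Pi.add_apply, id]
      rw [hm1, e1]; field_simp
    refine ⟨_, _, _, (hu.hasDerivAt_t y hs.1).sub ht1, (hu.hasSecondDerivAt y hs.1).sub
      ⟨Eventually.of_forall hx1, hx2⟩, ?_⟩
    have hφs := hφ y s hs.1.le
    have hup : 0 ≤ u y s := by linarith
    rw [reaction_of_nonneg hup]
    have hpow : ((w y s ^ (1 - p) + (1 - p) * s) ^ (1 / (1 - p))) ^ p
        = (w y s ^ (1 - p) + (1 - p) * s) ^ q := by
      rw [← Real.rpow_mul hYs.le, hqdef]; congr 1; ring
    have htan := rpow_sub_rpow_le hp0 hp1 hup (hws.trans_le hφs)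
    rw [hpow] at htan
    have hKle : ((w y s ^ (1 - p) + (1 - p) * s) ^ (1 / (1 - p))) ^ (p - 1) ≤ ε ^ (p - 1) :=
      Real.rpow_le_rpow_of_nonpos hε ((hw y s).trans hφs) (by linarith)
    have hK2 := mul_le_mul_of_nonneg_right (mul_le_mul_of_nonneg_left hKle hp0.le) hD.le
    simp only [e1, Pi.mul_apply]
    set Y := w y s ^ (1 - p) + (1 - p) * s with hYdef
    have hYq : Y ^ (q - 1) * Y = Y ^ q := by
      rw [← Real.rpow_add_one hYs.ne']; congr 1; ring
    have e2 : w y s ^ (-p - 1) * w y s = w y s ^ (-p) := by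
      rw [← Real.rpow_add_one hws.ne']; congr 1; ring
    have e3 : w y s ^ (1 - p) = w y s * w y s ^ (-p) := by
      rw [← Real.rpow_one_add' hws.le (by linarith)]; rfl
    have e4 : (1 - p) * q = p := by rw [hqdef]; field_simp
    -- The left side is the second derivative of the ODE flow in its initial value, times w_x². Its
    -- sign is the concavity of the flow; the remaining terms satisfy the equation exactly.
    have hcross : w' y s * (1 - p) * w y s ^ (-p) * q * Y ^ (q - 1) * (w y s ^ (-p) * w' y s) +
        Y ^ q * (w' y s * -p * w y s ^ (-p - 1) * w' y s) ≤ 0 := by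
      have : w' y s * (1 - p) * w y s ^ (-p) * q * Y ^ (q - 1) * (w y s ^ (-p) * w' y s) +
        Y ^ q * (w' y s * -p * w y s ^ (-p - 1) * w' y s) =
          -(p * w' y s ^ 2 * w y s ^ (-p - 1) * Y ^ (q - 1) * ((1 - p) * s)) := by
        rw [← hYq, ← e2]
        have : Y = w y s * (w y s ^ (-p - 1) * w y s) + (1 - p) * s := by rw [e2, ← e3]
        linear_combination (w' y s ^ 2 * w y s ^ (-p - 1) * w y s * Y ^ (q - 1) *
          w y s ^ (-p - 1) * w y s) * e4 - (p * w' y s ^ 2 * w y s ^ (-p - 1) * Y ^ (q - 1)) * this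
      rw [this]
      have := hs.1
      have : 0 ≤ p * w' y s ^ 2 * w y s ^ (-p - 1) * Y ^ (q - 1) * ((1 - p) * s) := by positivity
      linarith
    linarith

end IsGlobalSolution

/-! ### The homogeneous state -/

theorem continuous_homState {p : ℝ} (hp1 : p < 1) : Continuous (homState p) := by
  have hq : 0 < 1 - p := by linarith
  unfold homState
  exact Continuous.rpow_const (by fun_prop) fun _ => Or.inr (one_div_pos.2 hq).le

theorem homState_zero {p : ℝ} (hp1 : p < 1) : homState p 0 = 0 := by
  have hq : 0 < 1 - p := by linarith
  rw [homState, mul_zero, Real.zero_rpow (one_div_pos.2 hq).ne']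

theorem homState_pos {p t : ℝ} (hp1 : p < 1) (ht : 0 < t) : 0 < homState p t :=
  Real.rpow_pos_of_pos (mul_pos (by linarith) ht) _

theorem homState_nonneg {p t : ℝ} (hp1 : p < 1) (ht : 0 ≤ t) : 0 ≤ homState p t :=
  Real.rpow_nonneg (mul_nonneg (by linarith) ht) _

theorem hasDerivAt_homState {p t : ℝ} (hp1 : p < 1) (ht : 0 < t) :
    HasDerivAt (homState p) (homState p t ^ p) t := by
  have hq : 0 < 1 - p := by linarith
  have hpos : 0 < (1 - p) * t := mul_pos hq ht
  refine (((hasDerivAt_id t).const_mul (1 - p)).rpow_const (p := 1 / (1 - p))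
    (Or.inl hpos.ne')).congr_deriv ?_
  have e : 1 / (1 - p) * p = 1 / (1 - p) - 1 := by field_simp; ring
  simp only [id, homState]
  rw [← Real.rpow_mul hpos.le, e]
  field_simp

/-- Along the ODE flow Y^(1/(1-p)) the reaction has slope p / Y, with Y affine in time. -/
theorem rpow_one_div_rpow_sub_one {p Y : ℝ} (hp1 : p < 1) (hY : 0 ≤ Y) :
    (Y ^ (1 / (1 - p))) ^ (p - 1) = Y⁻¹ := by
  have hq : 0 < 1 - p := by linarith
  rw [← Real.rpow_mul hY, show 1 / (1 - p) * (p - 1) = -1 by field_simp; ring, Real.rpow_neg_one]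

/-! ### Bounds for the solution and for its excess -/

namespace IsGlobalSolution

variable {p : ℝ} {u₀ : ℝ → ℝ} {u : ℝ → ℝ → ℝ} (hu : IsGlobalSolution p u₀ u)
include hu

theorem continuousOn_time (x : ℝ) : ContinuousOn (fun t => u x t) (Ici 0) :=
  hu.cont.comp (f := fun t : ℝ => (x, t)) (by fun_prop) fun _ ht => ⟨mem_univ _, ht⟩

/-- Comparison with a localized subsolution `A(s) cos (k (x - x₀))` started at a positive time. -/
theorem localized_lower_bound (hp0 : 0 < p) (hp1 : p < 1) (h₀ : KPlus u₀) (x₀ : ℝ) {τ s k : ℝ}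
    (hτ : 0 < τ) (hs : 0 ≤ s) (hk : 0 < k) :
    ((1 - Real.exp (-((1 - p) * k ^ 2 * s))) / k ^ 2) ^ (1 / (1 - p)) ≤ u x₀ (τ + s) := by
  have hq : 0 < 1 - p := by linarith
  have hm : 0 < 1 / (1 - p) := one_div_pos.2 hq
  have hpi := Real.pi_pos
  -- A = B^(1/(1-p)) is the nonzero solution of A' = A^p - k²A with A(0) = 0: linear decay of the
  -- cosine mode against the reaction.
  set B : ℝ → ℝ := fun r => (1 - Real.exp (-((1 - p) * k ^ 2 * r))) / k ^ 2 with hB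
  -- Clamping the phase extends the half-wave of the cosine by zero to the whole line.
  set θ : ℝ → ℝ := fun y => max (-(Real.pi / 2)) (min (Real.pi / 2) (k * (y - x₀))) with hθ
  have hθc : Continuous θ := by fun_prop
  have hBc : Continuous B := by fun_prop
  have hBpos : ∀ r, 0 < r → 0 < B r := fun r hr => by
    have : Real.exp (-((1 - p) * k ^ 2 * r)) < 1 := Real.exp_lt_one_iff.2 (by
      have : 0 < (1 - p) * k ^ 2 * r := by positivity
      linarith)
    exact div_pos (by linarith) (by positivity)
  have hBle : ∀ r, B r ≤ 1 / k ^ 2 := fun r => by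
    have := Real.exp_pos (-((1 - p) * k ^ 2 * r))
    simp only [hB]; gcongr; linarith
  have hB0 : B 0 = 0 := by simp [hB]
  have hB' : ∀ r, HasDerivAt B ((1 - p) * (1 - k ^ 2 * B r)) r := fun r => by
    have := (((((hasDerivAt_id r).const_mul ((1 - p) * k ^ 2)).neg.exp).const_sub 1)).div_const (k ^ 2)
    refine this.congr_deriv ?_
    simp only [hB, id, Pi.neg_apply]
    field_simp
    ring
  have hBnn : ∀ r, 0 ≤ r → 0 ≤ B r := fun r hr => by
    rcases hr.eq_or_lt with h | h
    · rw [← h, hB0]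
    · exact (hBpos r h).le
  have hcomp : IsCompact (Icc (x₀ - Real.pi / 2 / k) (x₀ + Real.pi / 2 / k) ×ˢ Icc 0 s) :=
    isCompact_Icc.prod isCompact_Icc
  have hcont := hu.continuousOn_strip (τ := τ) (T := s) hτ.le
  -- The bump is positive only over this compact box, where u has a positive minimum m; this makes
  -- the reaction Lipschitz where it matters. The start at τ > 0 is what makes u positive.
  obtain ⟨⟨y₁, s₁⟩, hz₁, hmin⟩ := hcomp.exists_isMinOn
    ⟨(x₀, s), ⟨by have : 0 < Real.pi / 2 / k := by positivity
                  constructor <;> linarith, ⟨hs, le_rfl⟩⟩⟩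
    (hcont.mono (prod_mono (subset_univ _) le_rfl))
  set m := u y₁ (τ + s₁) with hmdef
  have hmpos : 0 < m := hu.pos h₀ _ (by linarith [hz₁.2.1])
  have key := max_principle (D := fun y r => B r ^ (1 / (1 - p)) * Real.cos (θ y) - u y (τ + r))
    (T := s) (K := p * m ^ (p - 1)) (M := (1 / k ^ 2) ^ (1 / (1 - p))) (by positivity)
    ?_ ?_ ?_ ?_ x₀ s ⟨hs, le_rfl⟩
  · have : θ x₀ = 0 := by
      simp only [hθ, sub_self, mul_zero]
      rw [min_eq_right (by positivity), max_eq_right (by linarith)]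
    simp only [this, Real.cos_zero, mul_one] at key
    linarith
  · refine ContinuousOn.sub (Continuous.continuousOn ?_) hcont
    exact ((hBc.comp continuous_snd).rpow_const fun _ => Or.inr hm.le).mul
      (Real.continuous_cos.comp (hθc.comp continuous_fst))
  · intro y r hr
    have h1 := (hu.pos h₀ y (by linarith [hr.1] : 0 < τ + r))
    have h2 : B r ^ (1 / (1 - p)) * Real.cos (θ y) ≤ B r ^ (1 / (1 - p)) :=
      mul_le_of_le_one_right (Real.rpow_nonneg (hBnn r hr.1) _) (Real.cos_le_one _)
    have h3 := Real.rpow_le_rpow (hBnn r hr.1) (hBle r) hm.le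
    linarith
  · intro y
    simp only [hB0, Real.zero_rpow hm.ne', zero_mul, add_zero]
    linarith [hu.pos h₀ y hτ]
  · intro y r hr hD
    have hτr : 0 < τ + r := by linarith [hr.1]
    have hupos := hu.pos h₀ y hτr
    have hBr := hBpos r hr.1
    have hApos : 0 < B r ^ (1 / (1 - p)) := Real.rpow_pos_of_pos hBr _
    have hy : |k * (y - x₀)| < Real.pi / 2 := by
      by_contra! hn
      have : Real.cos (θ y) = 0 := by
        rcases le_abs.1 hn with h | h
        · have : θ y = Real.pi / 2 := by
            simp only [hθ]; rw [min_eq_left h, max_eq_right (by linarith)]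
          rw [this, Real.cos_pi_div_two]
        · have : θ y = -(Real.pi / 2) := by
            simp only [hθ]; rw [max_eq_left ((min_le_right _ _).trans (by linarith))]
          rw [this, Real.cos_neg, Real.cos_pi_div_two]
      simp only [this, mul_zero] at hD
      linarith
    have hev : (fun z => Real.cos (θ z)) =ᶠ[𝓝 y] fun z => Real.cos (k * (z - x₀)) := by
      have hc : Continuous fun z => |k * (z - x₀)| := by fun_prop
      filter_upwards [hc.continuousAt.eventually_lt continuousAt_const hy] with z hz
      have := abs_lt.1 hz
      simp only [hθ]; rw [min_eq_right this.2.le, max_eq_right this.1.le]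
    have hθy := hev.self_of_nhds
    simp only at hθy
    have hlin : ∀ z, HasDerivAt (fun z => k * (z - x₀)) (k * 1) z := fun z =>
      ((hasDerivAt_id z).sub_const x₀).const_mul k
    have hcos : HasSecondDerivAt (fun z => Real.cos (θ z))
        (fun z => -Real.sin (k * (z - x₀)) * (k * 1))
        (-(Real.cos (k * (y - x₀)) * (k * 1)) * (k * 1)) y :=
      HasSecondDerivAt.congr_of_eventuallyEq
        ⟨Eventually.of_forall fun z => (hlin z).cos, ((hlin y).sin.neg).mul_const (k * 1)⟩ hev
    have hut : HasDerivAt (fun r => u y (τ + r)) _ r :=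
      (hu.hasDerivAt_t y hτr).comp_const_add τ r
    refine ⟨_, _, _, (((hB' r).rpow_const (p := 1 / (1 - p)) (Or.inl hBr.ne')).mul_const
      (Real.cos (θ y))).sub hut, (hcos.const_mul _).sub (hu.hasSecondDerivAt y hτr), ?_⟩
    rw [reaction_of_nonneg hupos.le]
    rw [hθy] at hD ⊢
    set c := Real.cos (k * (y - x₀)) with hc
    set A := B r ^ (1 / (1 - p)) with hA
    have hcpos : 0 < c := Real.cos_pos_of_mem_Ioo ⟨(abs_lt.1 hy).1, (abs_lt.1 hy).2⟩
    have hA' : (1 - p) * (1 - k ^ 2 * B r) * (1 / (1 - p)) * B r ^ (1 / (1 - p) - 1)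
        = A ^ p - k ^ 2 * A := by
      have e1 : A ^ p = B r ^ (1 / (1 - p) - 1) := by
        rw [hA, ← Real.rpow_mul hBr.le]; congr 1; field_simp; ring
      have e2 : A = B r ^ (1 / (1 - p) - 1) * B r := by
        rw [← Real.rpow_add_one hBr.ne', sub_add_cancel]
      rw [e1, e2]; field_simp
    rw [hA']
    -- For 0 < c ≤ 1 and p < 1 this gives A^p c ≤ (A c)^p, so the bump is a subsolution.
    have hcp : c ≤ c ^ p := by
      have := Real.rpow_le_rpow_of_exponent_ge hcpos (Real.cos_le_one _) hp1.le
      rwa [Real.rpow_one] at this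
    have hAc : A ^ p * c ≤ (A * c) ^ p := by
      rw [Real.mul_rpow hApos.le hcpos.le]; gcongr
    have htan := rpow_sub_rpow_le hp0 hp1 (mul_nonneg hApos.le hcpos.le) hupos
    have hmu : m ≤ u y (τ + r) := by
      have hin : (y, r) ∈ Icc (x₀ - Real.pi / 2 / k) (x₀ + Real.pi / 2 / k) ×ˢ Icc 0 s := by
        have h1 := abs_lt.1 hy
        have h2 : y - x₀ < Real.pi / 2 / k := by rw [lt_div_iff₀ hk]; linarith
        have h3 : -(y - x₀) < Real.pi / 2 / k := by rw [lt_div_iff₀ hk]; linarith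
        exact ⟨⟨by linarith, by linarith⟩, hr.1.le, hr.2⟩
      exact hmin hin
    have hK := mul_le_mul_of_nonneg_right (mul_le_mul_of_nonneg_left
      (Real.rpow_le_rpow_of_nonpos hmpos hmu (by linarith : p - 1 ≤ 0)) hp0.le) hD.le
    linarith

/-- The homogeneous state is a lower bound for every nontrivial solution. -/
theorem homState_le (hp0 : 0 < p) (hp1 : p < 1) (h₀ : KPlus u₀) (x : ℝ) {t : ℝ} (ht : 0 ≤ t) :
    homState p t ≤ u x t := by
  have hq : 0 < 1 - p := by linarith
  have hm : 0 < 1 / (1 - p) := one_div_pos.2 hq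
  have hshift : ∀ τ, 0 < τ → homState p t ≤ u x (τ + t) := fun τ hτ => by
    -- The wavelength tends to infinity. The bound 1 - e^(-y) ≥ y/(1+y) replaces the amplitude by an
    -- expression continuous at k = 0.
    have hlim : Tendsto (fun k : ℝ => ((1 - p) * t / (1 + (1 - p) * t * k ^ 2)) ^ (1 / (1 - p)))
        (𝓝[>] 0) (𝓝 (((1 - p) * t / (1 + (1 - p) * t * 0 ^ 2)) ^ (1 / (1 - p)))) := by
      refine Tendsto.mono_left ?_ nhdsWithin_le_nhds
      refine ContinuousAt.rpow_const ?_ (Or.inr hm.le)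
      exact ContinuousAt.div (by fun_prop) (by fun_prop) (by norm_num)
    have e : ((1 - p) * t / (1 + (1 - p) * t * 0 ^ 2)) ^ (1 / (1 - p)) = homState p t := by
      simp [homState]
    rw [e] at hlim
    refine le_of_tendsto hlim ?_
    filter_upwards [self_mem_nhdsWithin] with k (hk : 0 < k)
    refine le_trans ?_ (hu.localized_lower_bound hp0 hp1 h₀ x hτ ht hk)
    have ha : 0 ≤ (1 - p) * t := by positivity
    refine Real.rpow_le_rpow (by positivity) ?_ hm.le
    have hy : 0 ≤ (1 - p) * k ^ 2 * t := by positivity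
    have h1 := Real.add_one_le_exp ((1 - p) * k ^ 2 * t)
    rw [div_le_div_iff₀ (by positivity) (by positivity), Real.exp_neg]
    have h2 : (Real.exp ((1 - p) * k ^ 2 * t))⁻¹ ≤ ((1 - p) * k ^ 2 * t + 1)⁻¹ :=
      inv_anti₀ (by positivity) h1
    have h3 : ((1 - p) * k ^ 2 * t + 1)⁻¹ * (1 + (1 - p) * t * k ^ 2) = 1 := by
      rw [show (1 - p) * k ^ 2 * t + 1 = 1 + (1 - p) * t * k ^ 2 by ring]
      exact inv_mul_cancel₀ (by positivity)
    nlinarith [mul_le_mul_of_nonneg_right h2 (by positivity : 0 ≤ 1 + (1 - p) * t * k ^ 2)]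
  have hlim : Tendsto (fun τ => u x (τ + t)) (𝓝[>] 0) (𝓝 (u x (0 + t))) := by
    have h1 : ContinuousWithinAt (fun τ => u x (τ + t)) (Ioi 0) 0 := by
      refine ContinuousWithinAt.comp (g := fun s => u x s) (t := Ici 0)
        (hu.continuousOn_time x _ (by simpa using ht)) (by fun_prop) fun τ hτ => ?_
      exact add_nonneg (le_of_lt hτ) ht
    exact h1
  rw [zero_add] at hlim
  exact ge_of_tendsto hlim (by filter_upwards [self_mem_nhdsWithin] with τ hτ using hshift τ hτ)

theorem le_flow_const (hp0 : 0 < p) (hp1 : p < 1) (h₀ : KPlus u₀) (x : ℝ) {t : ℝ} (ht : 0 ≤ t) :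
    u x t ≤ (supNorm u₀ ^ (1 - p) + (1 - p) * t) ^ (1 / (1 - p)) :=
  hu.le_of_heat_supersolution hp0 hp1 (w := fun _ _ => supNorm u₀) (w' := fun _ _ => 0)
    (w'' := fun _ _ => 0) h₀.supNorm_pos (fun _ _ => le_rfl) continuous_const
    (fun _ _ _ => hasDerivAt_const _ _) (fun _ _ _ => hasDerivAt_const _ _)
    (fun _ _ _ => hasDerivAt_const _ _) h₀.le_supNorm x ht

theorem le_flow_heat (hp0 : 0 < p) (hp1 : p < 1) (h₀ : KPlus u₀) (x : ℝ) {t : ℝ} (ht : 0 ≤ t) :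
    u x t ≤ (heat u₀ x t ^ (1 - p) + (1 - p) * t) ^ (1 / (1 - p)) := by
  have hq : 0 < 1 - p := by linarith
  have hm : 0 < 1 / (1 - p) := one_div_pos.2 hq
  have hε : ∀ ε > 0, u x t ≤ ((heat u₀ x t + ε) ^ (1 - p) + (1 - p) * t) ^ (1 / (1 - p)) :=
    fun ε hε => hu.le_of_heat_supersolution hp0 hp1 (w := fun x t => heat u₀ x t + ε)
      (w' := heatX u₀) (w'' := heatXX u₀) hε
      (fun x t => by linarith [heat_nonneg h₀.nonneg x t])
      ((continuous_heat h₀.continuous h₀.abs_le_supNorm).add continuous_const)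
      (fun x t ht => (hasDerivAt_heat_t h₀.integrable x ht).add_const ε)
      (fun x t ht => (hasDerivAt_heat_x h₀.integrable x ht).add_const ε)
      (fun x t ht => hasDerivAt_heat_xx h₀.integrable x ht)
      (fun x => by rw [heat_zero]; linarith) x ht
  have hlim : Tendsto (fun ε => ((heat u₀ x t + ε) ^ (1 - p) + (1 - p) * t) ^ (1 / (1 - p)))
      (𝓝[>] 0) (𝓝 (((heat u₀ x t + 0) ^ (1 - p) + (1 - p) * t) ^ (1 / (1 - p)))) := by
    refine Tendsto.mono_left (Continuous.tendsto ?_ 0) nhdsWithin_le_nhds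
    refine Continuous.rpow_const (Continuous.add ?_ continuous_const) fun _ => Or.inr hm.le
    exact Continuous.rpow_const (by fun_prop) fun _ => Or.inr hq.le
  rw [add_zero] at hlim
  exact ge_of_tendsto hlim (by filter_upwards [self_mem_nhdsWithin] with ε h using hε ε h)

/-- Lower bound for the excess over the homogeneous state, from below-linearization. -/
theorem excess_lower_bound (hp0 : 0 < p) (hp1 : p < 1) (h₀ : KPlus u₀) (x : ℝ) {t : ℝ}
    (ht : 0 ≤ t) :
    (1 + (1 - p) * t / supNorm u₀ ^ (1 - p)) ^ (p / (1 - p)) * heat u₀ x t ≤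
      u x t - homState p t := by
  have hq : 0 < 1 - p := by linarith
  have hm : 0 < 1 / (1 - p) := one_div_pos.2 hq
  have hMpos := h₀.supNorm_pos
  set M := supNorm u₀ with hM
  set N := M ^ (1 - p) with hN
  have hNpos : 0 < N := Real.rpow_pos_of_pos hMpos _
  set q := p / (1 - p) with hqdef
  have hq0 : 0 < q := div_pos hp0 hq
  have hAb : ∀ r, 0 ≤ r → 0 < 1 + (1 - p) * r / N := fun r hr => by positivity
  obtain ⟨L, hL⟩ := hu.bounded (t + 1) (by linarith)
  have key := max_principle
    (D := fun y r => (1 + (1 - p) * r / N) ^ q * heat u₀ y r - (u y r - homState p r))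
    (T := t) (K := p * N⁻¹) (M := (1 + (1 - p) * t / N) ^ q * M) (by positivity)
    ?_ ?_ ?_ ?_ x t ⟨ht, le_rfl⟩
  · linarith
  · have := hu.continuousOn_strip (τ := 0) (T := t) le_rfl
    simp only [zero_add] at this
    refine ContinuousOn.sub (Continuous.continuousOn ?_)
      (this.sub ((continuous_homState hp1).comp continuous_snd).continuousOn)
    exact (Continuous.rpow_const (by fun_prop) fun _ => Or.inr hq0.le).mul
      (continuous_heat h₀.continuous h₀.abs_le_supNorm)
  · intro y r hr
    have h1 := hu.homState_le hp0 hp1 h₀ y hr.1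
    have h2 : (1 + (1 - p) * r / N) ^ q * heat u₀ y r ≤ (1 + (1 - p) * t / N) ^ q * M := by
      refine mul_le_mul ?_ (SublinearFujita.heat_le h₀.continuous h₀.abs_le_supNorm y r)
        (heat_nonneg h₀.nonneg y r) (Real.rpow_nonneg (hAb t ht).le _)
      have := hr.2
      have := hAb r hr.1
      gcongr
    linarith
  · intro y
    simp [heat_zero, hu.initial, homState_zero hp1]
  · intro y r hr hD
    have hAr := hAb r hr.1.le
    have hA' := ((((hasDerivAt_id r).const_mul (1 - p)).div_const N).const_add 1).rpow_const
      (p := q) (Or.inl hAr.ne')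
    refine ⟨_, _, _, (hA'.mul (hasDerivAt_heat_t h₀.integrable y hr.1)).sub
      ((hu.hasDerivAt_t y hr.1).sub (hasDerivAt_homState hp1 hr.1)),
      ((hasSecondDerivAt_heat h₀.integrable y hr.1).const_mul _).sub
        ((hu.hasSecondDerivAt y hr.1).add_const (-homState p r)), ?_⟩
    simp only [id]
    have hupos := hu.pos h₀ y hr.1
    have hge := hu.homState_le hp0 hp1 h₀ y hr.1.le
    have hle := hu.le_flow_const hp0 hp1 h₀ y hr.1.le
    rw [← hM, ← hN] at hle
    rw [reaction_of_nonneg hupos.le]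
    have hY : 0 < N + (1 - p) * r := by have := hr.1; positivity
    -- The tangent is taken at u, the larger point, to bound the source from below.
    have htan := rpow_sub_rpow_le hp0 hp1 (homState_nonneg hp1 hr.1.le) hupos
    have hpw : (N + (1 - p) * r)⁻¹ ≤ u y r ^ (p - 1) := by
      rw [← rpow_one_div_rpow_sub_one hp1 hY.le]
      exact Real.rpow_le_rpow_of_nonpos hupos hle (by linarith)
    have h1 : p * (N + (1 - p) * r)⁻¹ * (u y r - homState p r)
        ≤ p * u y r ^ (p - 1) * (u y r - homState p r) :=
      mul_le_mul_of_nonneg_right (mul_le_mul_of_nonneg_left hpw hp0.le) (by linarith)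
    -- The growth factor solves A' = p A / (N + (1-p)r), the linear equation with the lower slope.
    have h2 : (1 - p) * 1 / N * q * (1 + (1 - p) * r / N) ^ (q - 1)
        = p * (N + (1 - p) * r)⁻¹ * (1 + (1 - p) * r / N) ^ q := by
      rw [Real.rpow_sub_one hAr.ne', hqdef]
      have : 1 + (1 - p) * r / N = (N + (1 - p) * r) / N := by field_simp
      rw [this]
      field_simp
    have h3 : (N + (1 - p) * r)⁻¹ ≤ N⁻¹ :=
      inv_anti₀ hNpos (by have := hr.1; nlinarith)
    have h4 := mul_le_mul_of_nonneg_right (mul_le_mul_of_nonneg_left h3 hp0.le) hD.le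
    rw [h2]
    linarith

/-- Upper bound for the excess over the homogeneous state after time one. -/
theorem excess_upper_bound (hp0 : 0 < p) (hp1 : p < 1) (h₀ : KPlus u₀)
    (hEc : Continuous (calE p u₀)) (hEi : Integrable (calE p u₀)) {L : ℝ}
    (hE0 : ∀ y, 0 ≤ calE p u₀ y) (hEb : ∀ y, |calE p u₀ y| ≤ L) (x : ℝ) {s : ℝ} (hs : 0 ≤ s) :
    u x (1 + s) - homState p (1 + s) ≤ (1 + s) ^ (p / (1 - p)) * heat (calE p u₀) x s := by
  have hq : 0 < 1 - p := by linarith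
  have hm : 0 < 1 / (1 - p) := one_div_pos.2 hq
  set q := p / (1 - p) with hqdef
  have hq0 : 0 < q := div_pos hp0 hq
  obtain ⟨M, hM⟩ := hu.bounded (1 + s) (by linarith)
  have key := max_principle
    (D := fun y r => u y (1 + r) - (homState p (1 + r) + (1 + r) ^ q * heat (calE p u₀) y r))
    (T := s) (K := q) (M := M) hq0.le ?_ ?_ ?_ ?_ x s ⟨hs, le_rfl⟩
  · linarith
  · refine ContinuousOn.sub (hu.continuousOn_strip zero_le_one) (Continuous.continuousOn ?_)
    refine ((continuous_homState hp1).comp (by fun_prop)).add (Continuous.mul ?_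
      (continuous_heat hEc hEb))
    exact Continuous.rpow_const (by fun_prop) fun _ => Or.inr hq0.le
  · intro y r hr
    have h1 := (abs_le.1 (hM y (1 + r) (by linarith [hr.1]) (by linarith [hr.2]))).2
    have h2 := homState_nonneg hp1 (by linarith [hr.1] : 0 ≤ 1 + r)
    have h3 : 0 ≤ (1 + r) ^ q * heat (calE p u₀) y r :=
      mul_nonneg (Real.rpow_nonneg (by linarith [hr.1]) _) (heat_nonneg hE0 y r)
    linarith
  -- At time one the excess is at most `calE`, because `Delta` is the heat flow of u₀ at time one.
  · intro y
    have h1 := hu.le_flow_heat hp0 hp1 h₀ y zero_le_one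
    rw [heat_zero, add_zero, Real.one_rpow, one_mul, calE, h₀.delta_eq_heat, homState]
    rw [mul_one, add_comm] at h1
    rw [mul_one]
    linarith
  · intro y r hr hD
    have hr1 : 0 < 1 + r := by linarith [hr.1]
    have hA' := ((hasDerivAt_id r).const_add 1).rpow_const (p := q) (Or.inl hr1.ne')
    refine ⟨_, _, _, ((hu.hasDerivAt_t y hr1).comp_const_add 1 r).sub
      (((hasDerivAt_homState hp1 hr1).comp_const_add 1 r).add
        (hA'.mul (hasDerivAt_heat_t hEi y hr.1))),
      (hu.hasSecondDerivAt y hr1).sub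
        (((hasSecondDerivAt_heat hEi y hr.1).const_mul ((1 + r) ^ q)).add_const
          (homState p (1 + r)) |>.congr_of_eventuallyEq
            (Eventually.of_forall fun z => add_comm _ _)), ?_⟩
    simp only [id]
    have hupos := hu.pos h₀ y hr1
    have hhpos := homState_pos hp1 hr1
    rw [reaction_of_nonneg hupos.le]
    -- The tangent is now taken at the homogeneous state; its slope q/(1+r) integrates to the factor
    -- (1+r)^q.
    have htan := rpow_sub_rpow_le hp0 hp1 hupos.le hhpos
    have hpw : p * homState p (1 + r) ^ (p - 1) = q * (1 + r)⁻¹ := by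
      rw [homState, rpow_one_div_rpow_sub_one hp1 (by positivity), hqdef, mul_inv]; field_simp
    rw [hpw] at htan
    have h2 : (1 + r) ^ (q - 1) = (1 + r)⁻¹ * (1 + r) ^ q := by
      rw [Real.rpow_sub_one hr1.ne']; field_simp
    rw [h2]
    have h3 : (1 + r)⁻¹ ≤ 1 := inv_le_one_of_one_le₀ (by linarith [hr.1])
    have h4 := mul_le_mul_of_nonneg_right (mul_le_mul_of_nonneg_left h3 hq0.le) hD.le
    linarith

end IsGlobalSolution

/-! ### The profile at time one -/

theorem rpow_sub_rpow_le_of_one_le {m a b : ℝ} (hm : 1 ≤ m) (ha : 0 ≤ a) (hb : 0 < b) :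
    b ^ m - a ^ m ≤ m * b ^ (m - 1) * (b - a) := by
  have h := one_add_mul_self_le_rpow_one_add (s := a / b - 1)
    (by have : 0 ≤ a / b := by positivity
        linarith) hm
  rw [add_sub_cancel, Real.div_rpow ha hb.le, le_div_iff₀ (by positivity)] at h
  rw [Real.rpow_sub_one hb.ne']
  have : (1 + m * (a / b - 1)) * b ^ m = b ^ m - m * (b ^ m / b) * (b - a) := by
    field_simp; ring
  linarith

namespace KPlus

variable {u₀ : ℝ → ℝ} (h : KPlus u₀) {p : ℝ} (hp1 : p < 1)
include h

theorem continuous_delta : Continuous (Delta u₀) := by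
  have : Delta u₀ = fun s => heat u₀ s 1 := funext h.delta_eq_heat
  rw [this]
  exact (continuous_heat h.continuous h.abs_le_supNorm).comp (by fun_prop : Continuous
    fun s : ℝ => (s, (1 : ℝ)))

theorem delta_pos (s : ℝ) : 0 < Delta u₀ s := by
  rw [h.delta_eq_heat]
  exact heat_pos h.continuous h.abs_le_supNorm h.nonneg h.nontrivial s one_pos

theorem delta_le_supNorm (s : ℝ) : Delta u₀ s ≤ supNorm u₀ := by
  rw [h.delta_eq_heat]
  exact heat_le h.continuous h.abs_le_supNorm s 1

theorem delta_le_gaussian (s : ℝ) :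
    Delta u₀ s ≤ (∫ w, u₀ w) * (1 / (2 * √Real.pi) * Real.exp (1 / 4)) *
      Real.exp (-(1 / 8) * s ^ 2) := by
  have hpi := Real.sqrt_pos.2 Real.pi_pos
  rw [h.delta_eq_heat, heat_eq_kernel u₀ s one_pos, mul_assoc, ← integral_mul_const]
  refine integral_mono (integrable_mul_kernel h.integrable s one_pos) (h.integrable.mul_const _)
    fun w => ?_
  by_cases hw : u₀ w = 0
  · simp [hw]
  · have hw1 := h.support_subset_Ioo hw
    refine mul_le_mul_of_nonneg_left ?_ (h.nonneg w)
    rw [heatKernel, mul_assoc, ← Real.exp_add, Real.sqrt_one, inv_one, one_mul]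
    have : -((s - w) ^ 2 / (4 * 1)) ≤ 1 / 4 + -(1 / 8) * s ^ 2 := by
      -- The difference of the two sides is (s - 2w)²/8 + (1 - w²)/4.
      nlinarith [hw1.1, hw1.2, sq_nonneg (s - 2 * w)]
    gcongr

include hp1

theorem continuous_calE : Continuous (calE p u₀) := by
  have hq : 0 < 1 - p := by linarith
  unfold calE
  refine Continuous.sub (Continuous.rpow_const (continuous_const.add ?_)
    fun _ => Or.inr (one_div_pos.2 hq).le) continuous_const
  exact h.continuous_delta.rpow_const fun _ => Or.inr hq.le

theorem calE_pos (s : ℝ) : 0 < calE p u₀ s := by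
  have hq : 0 < 1 - p := by linarith
  have h1 := Real.rpow_pos_of_pos (h.delta_pos s) (1 - p)
  have := Real.rpow_lt_rpow hq.le (by linarith : 1 - p < (1 - p) + Delta u₀ s ^ (1 - p))
    (one_div_pos.2 hq)
  unfold calE; linarith

theorem abs_calE_le (s : ℝ) :
    |calE p u₀ s| ≤ ((1 - p) + supNorm u₀ ^ (1 - p)) ^ (1 / (1 - p)) := by
  have hq : 0 < 1 - p := by linarith
  rw [abs_of_pos (h.calE_pos hp1 s), calE]
  have h1 := Real.rpow_pos_of_pos (h.delta_pos s) (1 - p)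
  have h2 := Real.rpow_le_rpow (h.delta_pos s).le (h.delta_le_supNorm s) hq.le
  have h3 := Real.rpow_le_rpow (by linarith)
    (by linarith : (1 - p) + Delta u₀ s ^ (1 - p) ≤ (1 - p) + supNorm u₀ ^ (1 - p))
    (one_div_pos.2 hq).le
  have := Real.rpow_pos_of_pos hq (1 / (1 - p))
  linarith

/-- The outer power has exponent at least 1, so its tangent bounds `calE` by a constant times
Δ^(1-p), which keeps Gaussian decay, at rate (1-p)/8. -/
theorem integrable_calE (hp0 : 0 < p) : Integrable (calE p u₀) := by
  have hq : 0 < 1 - p := by linarith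
  have hm : 1 ≤ 1 / (1 - p) := by rw [le_div_iff₀ hq]; linarith
  set m := 1 / (1 - p) with hmdef
  set C := (∫ w, u₀ w) * (1 / (2 * √Real.pi) * Real.exp (1 / 4)) with hC
  have hCpos : 0 < C := by
    have hpi := Real.sqrt_pos.2 Real.pi_pos
    have := h.integral_pos
    positivity
  have hNpos := Real.rpow_pos_of_pos h.supNorm_pos (1 - p)
  refine ((integrable_exp_neg_mul_sq (b := (1 - p) / 8) (by positivity)).const_mul
    (m * ((1 - p) + supNorm u₀ ^ (1 - p)) ^ (m - 1) * C ^ (1 - p))).mono'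
    (h.continuous_calE hp1).aestronglyMeasurable (Eventually.of_forall fun s => ?_)
  rw [Real.norm_of_nonneg (h.calE_pos hp1 s).le, calE]
  have h1 := Real.rpow_pos_of_pos (h.delta_pos s) (1 - p)
  have h2 := Real.rpow_le_rpow (h.delta_pos s).le (h.delta_le_supNorm s) hq.le
  have h3 := rpow_sub_rpow_le_of_one_le hm hq.le
    (by linarith : 0 < (1 - p) + Delta u₀ s ^ (1 - p))
  rw [add_sub_cancel_left] at h3
  have h4 : Delta u₀ s ^ (1 - p) ≤ C ^ (1 - p) * Real.exp (-((1 - p) / 8) * s ^ 2) := by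
    refine (Real.rpow_le_rpow (h.delta_pos s).le (h.delta_le_gaussian s) hq.le).trans_eq ?_
    rw [Real.mul_rpow hCpos.le (Real.exp_pos _).le, ← Real.exp_mul]
    congr 2; ring
  have h5 : ((1 - p) + Delta u₀ s ^ (1 - p)) ^ (m - 1)
      ≤ ((1 - p) + supNorm u₀ ^ (1 - p)) ^ (m - 1) :=
    Real.rpow_le_rpow (by linarith) (by linarith) (by linarith)
  refine h3.trans ?_
  rw [mul_assoc _ (C ^ (1 - p))]
  have h6 : 0 ≤ ((1 - p) + supNorm u₀ ^ (1 - p)) ^ (m - 1) := by positivity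
  gcongr

theorem integral_calE_pos (hp0 : 0 < p) : 0 < ∫ s, calE p u₀ s :=
  integral_pos_of_integrable_nonneg_nonzero (x := 0) (h.continuous_calE hp1)
    (h.integrable_calE hp1 hp0) (fun s => (h.calE_pos hp1 s).le) (h.calE_pos hp1 0).ne'

end KPlus

/-- Reaction growth against heat decay: p/(1-p) - 1/2 is the exponent that vanishes at p = 1/3. -/
theorem rpow_mul_inv_sqrt {p t : ℝ} (hp1 : p < 1) (ht : 0 < t) :
    t ^ (p / (1 - p)) * (√t)⁻¹ = t ^ ((3 * p - 1) / (2 * (1 - p))) := by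
  have hq : 0 < 1 - p := by linarith
  rw [Real.sqrt_eq_rpow, ← Real.rpow_neg ht.le, ← Real.rpow_add ht]
  congr 1; field_simp; ring

/-! ### Two-sided algebraic rate -/

namespace IsGlobalSolution

variable {p : ℝ} {u₀ : ℝ → ℝ} {u : ℝ → ℝ → ℝ} (hu : IsGlobalSolution p u₀ u)
include hu

theorem supExcess_le (hp0 : 0 < p) (hp1 : p < 1) (h₀ : KPlus u₀) {t : ℝ} (ht : 2 ≤ t) :
    supExcess p u t ≤ 1 / √(2 * Real.pi) * (∫ s, calE p u₀ s) *
      t ^ ((3 * p - 1) / (2 * (1 - p))) := by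
  have hpi := Real.sqrt_pos.2 Real.pi_pos
  have ht0 : 0 < t := by linarith
  have hI := h₀.integral_calE_pos hp1 hp0
  refine ciSup_le fun x => ?_
  have h1 := hu.excess_upper_bound hp0 hp1 h₀ (h₀.continuous_calE hp1)
    (h₀.integrable_calE hp1 hp0) (fun y => (h₀.calE_pos hp1 y).le) (h₀.abs_calE_le hp1) x
    (by linarith : 0 ≤ t - 1)
  rw [add_sub_cancel] at h1
  refine h1.trans ?_
  have h2 := heat_le_integral (h₀.integrable_calE hp1 hp0) (fun y => (h₀.calE_pos hp1 y).le) x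
    (by linarith : 0 < t - 1)
  -- For t ≥ 2 one has t - 1 ≥ t/2. The resulting √2 turns 1/(2√π) into the 1/√(2π) of `cPlus`.
  have h3 : (√(t - 1))⁻¹ ≤ √2 * (√t)⁻¹ := by
    have hst := Real.sqrt_pos.2 ht0
    have h4 : √t ≤ √2 * √(t - 1) := by
      rw [← Real.sqrt_mul (by norm_num)]
      exact Real.sqrt_le_sqrt (by linarith)
    have h5 : 0 < √(t - 1) := Real.sqrt_pos.2 (by linarith)
    rw [← div_eq_mul_inv, inv_eq_one_div, div_le_div_iff₀ h5 hst]
    linarith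
  calc t ^ (p / (1 - p)) * heat (calE p u₀) x (t - 1)
      ≤ t ^ (p / (1 - p)) * (1 / (2 * √Real.pi) * (√2 * (√t)⁻¹) * ∫ s, calE p u₀ s) := by
        refine mul_le_mul_of_nonneg_left (h2.trans ?_) (by positivity)
        gcongr
    _ = 1 / √(2 * Real.pi) * (∫ s, calE p u₀ s) * (t ^ (p / (1 - p)) * (√t)⁻¹) := by
        have h6 : 1 / √(2 * Real.pi) = 1 / (2 * √Real.pi) * √2 := by
          have h7 : √2 * √2 = 2 := Real.mul_self_sqrt (by norm_num)
          have h8 : 0 < √2 := by positivity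
          rw [Real.sqrt_mul (by norm_num)]
          field_simp
          linarith
        rw [h6]; ring
    _ = _ := by rw [rpow_mul_inv_sqrt hp1 ht0]

theorem le_supExcess (hp0 : 0 < p) (hp1 : p < 1) (h₀ : KPlus u₀) {t : ℝ} (ht : 2 ≤ t) :
    ((1 - p) / supNorm u₀ ^ (1 - p)) ^ (p / (1 - p)) * (1 / (2 * √Real.pi)) * (7 / 8) *
      (∫ s, u₀ s) * t ^ ((3 * p - 1) / (2 * (1 - p))) ≤ supExcess p u t := by
  have hq : 0 < 1 - p := by linarith
  have hpi := Real.sqrt_pos.2 Real.pi_pos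
  have ht0 : 0 < t := by linarith
  have hI := h₀.integral_pos
  have hN := Real.rpow_pos_of_pos h₀.supNorm_pos (1 - p)
  -- Needed because the supremum of an unbounded family is 0 by default.
  have hbdd : BddAbove (range fun x => u x t - homState p t) := by
    obtain ⟨M, hM⟩ := hu.bounded t ht0
    refine ⟨M - homState p t, ?_⟩
    rintro _ ⟨x, rfl⟩
    have := (abs_le.1 (hM x t ht0.le le_rfl)).2
    simp only; linarith
  refine le_trans ?_ (le_ciSup hbdd 0)
  refine le_trans ?_ (hu.excess_lower_bound hp0 hp1 h₀ 0 ht0.le)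
  have hexp : 7 / 8 ≤ Real.exp (-(1 / (4 * t))) := by
    have h1 := Real.add_one_le_exp (-(1 / (4 * t)))
    have h2 : 1 / (4 * t) ≤ 1 / 8 := by gcongr; linarith
    linarith
  have h1 := le_heat_zero h₀.integrable h₀.nonneg
    (h₀.support_subset_Ioo.trans Ioo_subset_Icc_self) ht0
  calc _ = ((1 - p) / supNorm u₀ ^ (1 - p)) ^ (p / (1 - p)) * t ^ (p / (1 - p)) *
        (1 / (2 * √Real.pi) * (√t)⁻¹ * (7 / 8) * ∫ s, u₀ s) := by
        rw [← rpow_mul_inv_sqrt hp1 ht0]; ring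
    _ ≤ (1 + (1 - p) * t / supNorm u₀ ^ (1 - p)) ^ (p / (1 - p)) * heat u₀ 0 t := by
        refine mul_le_mul ?_ (le_trans ?_ h1) (by positivity) (by positivity)
        · rw [← Real.mul_rpow (by positivity) ht0.le]
          refine Real.rpow_le_rpow (by positivity) ?_ (by positivity)
          rw [div_mul_eq_mul_div]; linarith
        · gcongr

/-- Two-sided algebraic bounds for the excess. -/
theorem exists_rate_bounds (hp0 : 0 < p) (hp1 : p < 1) (h₀ : KPlus u₀) :
    ∃ c C : ℝ, 0 < c ∧ 0 < C ∧ ∀ᶠ t in atTop,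
      c * rate p t ≤ supExcess p u t ∧ supExcess p u t ≤ C * rate p t := by
  have hq : 0 < 1 - p := by linarith
  have hpi := Real.pi_pos
  have hI := h₀.integral_pos
  have hJ := h₀.integral_calE_pos hp1 hp0
  have hN := Real.rpow_pos_of_pos h₀.supNorm_pos (1 - p)
  have hr := Real.rpow_pos_of_pos hq ((3 * p - 1) / (2 * (1 - p)))
  refine ⟨((1 - p) / supNorm u₀ ^ (1 - p)) ^ (p / (1 - p)) * (1 / (2 * √Real.pi)) * (7 / 8) *
      (∫ s, u₀ s) / (1 - p) ^ ((3 * p - 1) / (2 * (1 - p))),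
    1 / √(2 * Real.pi) * (∫ s, calE p u₀ s) / (1 - p) ^ ((3 * p - 1) / (2 * (1 - p))),
    by positivity, by positivity, ?_⟩
  filter_upwards [eventually_ge_atTop 2] with t ht
  have e : ∀ a, a / (1 - p) ^ ((3 * p - 1) / (2 * (1 - p))) * rate p t =
      a * t ^ ((3 * p - 1) / (2 * (1 - p))) := fun a => by
    rw [rate, Real.mul_rpow hq.le (by linarith)]; field_simp
  rw [e, e]
  exact ⟨hu.le_supExcess hp0 hp1 h₀ ht, hu.supExcess_le hp0 hp1 h₀ ht⟩

end IsGlobalSolution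

/-! ### Limits of the rate and the critical constants -/

theorem rate_pos {p t : ℝ} (hp1 : p < 1) (ht : 0 < t) : 0 < rate p t :=
  Real.rpow_pos_of_pos (mul_pos (by linarith) ht) _

theorem tendsto_rate_zero {p : ℝ} (hp : p < 1 / 3) : Tendsto (rate p) atTop (𝓝 0) := by
  have hq : 0 < 1 - p := by linarith
  have h := (tendsto_rpow_neg_atTop (y := -((3 * p - 1) / (2 * (1 - p)))) (by
    rw [neg_pos]; exact div_neg_of_neg_of_pos (by linarith) (by linarith))).comp
    (tendsto_id.const_mul_atTop hq)
  rw [neg_neg] at h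
  exact h

theorem tendsto_rate_atTop {p : ℝ} (hp : 1 / 3 < p) (hp1 : p < 1) :
    Tendsto (rate p) atTop atTop := by
  have hq : 0 < 1 - p := by linarith
  exact (tendsto_rpow_atTop (y := (3 * p - 1) / (2 * (1 - p)))
    (div_pos (by linarith) (by linarith))).comp (tendsto_id.const_mul_atTop hq)

theorem KPlus.cMinus_pos {u₀ : ℝ → ℝ} (h : KPlus u₀) : 0 < cMinus u₀ := by
  have h1 := h.supNorm_pos
  have h2 := h.integral_pos
  have := Real.pi_pos
  rw [cMinus, h.intervalIntegral_eq]
  positivity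

theorem KPlus.cMinus_le {u₀ : ℝ → ℝ} (h : KPlus u₀) :
    cMinus u₀ ≤ ((1 - (1 / 3 : ℝ)) / supNorm u₀ ^ (1 - (1 / 3 : ℝ))) ^
      ((1 / 3 : ℝ) / (1 - 1 / 3)) * (1 / (2 * √Real.pi)) * (7 / 8) * ∫ s, u₀ s := by
  have hM := h.supNorm_pos
  have hI := h.integral_pos
  have hpi := Real.sqrt_pos.2 Real.pi_pos
  rw [cMinus, h.intervalIntegral_eq]
  refine mul_le_mul_of_nonneg_right ?_ hI.le
  set M := supNorm u₀
  set a := M ^ (1 / 3 : ℝ) with ha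
  have hapos : 0 < a := Real.rpow_pos_of_pos hM _
  have hM3 : M = a ^ 3 := by
    rw [ha, ← Real.rpow_natCast, ← Real.rpow_mul hM.le]; norm_num
  have hM2 : M ^ (1 - (1 / 3 : ℝ)) = a ^ 2 := by
    rw [ha, ← Real.rpow_natCast, ← Real.rpow_mul hM.le]; norm_num
  set k := √(2 / 3 : ℝ) with hk
  have hkpos : 0 < k := by positivity
  have hk2 : k ^ 2 = 2 / 3 := Real.sq_sqrt (by norm_num)
  have e1 : √(2 * Real.pi / 3) = k * √Real.pi := by
    rw [hk, ← Real.sqrt_mul (by norm_num)]; congr 1; ring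
  have e2 : ((1 - (1 / 3 : ℝ)) / a ^ 2) ^ ((1 / 3 : ℝ) / (1 - 1 / 3)) = k / a := by
    rw [show (1 / 3 : ℝ) / (1 - 1 / 3) = 1 / 2 by norm_num, ← Real.sqrt_eq_rpow,
      Real.sqrt_div (by norm_num), Real.sqrt_sq hapos.le, hk]
    norm_num
  rw [hM2, e2, e1, hM3, inv_eq_one_div, div_div, div_mul_div_comm, div_mul_div_comm,
    div_le_div_iff₀ (by positivity) (by positivity)]
  -- With M = a³ and k² = 2/3 the claim reduces to this cubic inequality. The point 19/25
  -- approximates its minimizer √(4/7), and the square expands to a³ - 3(19/25)² a + 2(19/25)³.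
  -- There is slack enough for the factor 7/8.
  have hcub : a * 12 ≤ 7 * (1 + a ^ 3) := by
    have : 0 ≤ (a - 19 / 25) ^ 2 * (a + 38 / 25) := by positivity
    nlinarith
  have e3 : k * 1 * 7 * ((1 + a ^ 3) * (2 * (k * √Real.pi))) =
      (4 / 3) * √Real.pi * (7 * (1 + a ^ 3)) := by
    linear_combination (14 * (1 + a ^ 3) * √Real.pi) * hk2
  rw [e3]
  nlinarith [mul_le_mul_of_nonneg_left hcub hpi.le]

theorem KPlus.cPlus_pos {u₀ : ℝ → ℝ} (h : KPlus u₀) : 0 < cPlus u₀ := by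
  have h1 := h.integral_calE_pos (p := 1 / 3) (by norm_num) (by norm_num)
  have := Real.pi_pos
  rw [cPlus]
  positivity

end SublinearFujita

end

theorem corollary1p1 (p : ℝ) (hp0 : 0 < p) (hp1 : p < 1)
    (u₀ : ℝ → ℝ) (hu₀ : SublinearFujita.KPlus u₀)
    (u : ℝ → ℝ → ℝ) (hu : SublinearFujita.IsGlobalSolution p u₀ u) :
    (p < 1 / 3 →
      Tendsto (SublinearFujita.supExcess p u) atTop (𝓝[>] 0) ∧
      ∃ c C : ℝ, 0 < c ∧ 0 < C ∧ ∀ᶠ t in atTop,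
        c * SublinearFujita.rate p t ≤ SublinearFujita.supExcess p u t ∧
        SublinearFujita.supExcess p u t ≤ C * SublinearFujita.rate p t) ∧
    (1 / 3 < p →
      Tendsto (SublinearFujita.supExcess p u) atTop atTop ∧
      ∃ c C : ℝ, 0 < c ∧ 0 < C ∧ ∀ᶠ t in atTop,
        c * SublinearFujita.rate p t ≤ SublinearFujita.supExcess p u t ∧
        SublinearFujita.supExcess p u t ≤ C * SublinearFujita.rate p t) ∧
    (p = 1 / 3 →
      0 < SublinearFujita.cMinus u₀ ∧ 0 < SublinearFujita.cPlus u₀ ∧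
      Integrable (SublinearFujita.calE (1 / 3) u₀) ∧
      ∀ᶠ t in atTop,
        SublinearFujita.cMinus u₀ ≤ SublinearFujita.supExcess p u t ∧
        SublinearFujita.supExcess p u t ≤ SublinearFujita.cPlus u₀) := by
  obtain ⟨c, C, hc, hC, hbd⟩ := hu.exists_rate_bounds hp0 hp1 hu₀
  refine ⟨fun hp => ⟨?_, c, C, hc, hC, hbd⟩, fun hp => ⟨?_, c, C, hc, hC, hbd⟩, fun hp => ?_⟩
  · have hpos : ∀ᶠ t in atTop, 0 < SublinearFujita.supExcess p u t := by
      filter_upwards [hbd, eventually_gt_atTop 0] with t h1 h2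
      exact (mul_pos hc (SublinearFujita.rate_pos hp1 h2)).trans_le h1.1
    refine tendsto_nhdsWithin_iff.2 ⟨?_, hpos⟩
    have h1 := (SublinearFujita.tendsto_rate_zero hp).const_mul C
    rw [mul_zero] at h1
    exact tendsto_of_tendsto_of_tendsto_of_le_of_le' tendsto_const_nhds h1
      (hpos.mono fun _ h => h.le) (hbd.mono fun _ h => h.2)
  · exact tendsto_atTop_mono' _ (hbd.mono fun _ h => h.1)
      ((SublinearFujita.tendsto_rate_atTop hp hp1).const_mul_atTop hc)
  · subst hp
    refine ⟨hu₀.cMinus_pos, hu₀.cPlus_pos, hu₀.integrable_calE hp1 hp0, ?_⟩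
    filter_upwards [eventually_ge_atTop 2] with t ht
    have h1 := hu.le_supExcess hp0 hp1 hu₀ ht
    have h2 := hu.supExcess_le hp0 hp1 hu₀ ht
    -- At the critical exponent the power of t disappears, so the bounds become constants, valid
    -- from t = 2 on.
    have e : (3 * (1 / 3 : ℝ) - 1) / (2 * (1 - 1 / 3)) = 0 := by norm_num
    rw [e, Real.rpow_zero, mul_one] at h1 h2
    exact ⟨hu₀.cMinus_le.trans h1, h2⟩
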